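/- Let $\kappa$ be an infinite regular cardinal (identified with its initial ordinal). For a set $X$ let $\mathcal{P}_{<\kappa}X$ be the set of subsets of $X$ with fewer than $\kappa$ elements, and $\mathcal{P}_{<\kappa}f(U)=f[U]$ for a map $f$; $\mathcal{P}$ is the full powerset functor. For $F=\mathcal{P}_{<\kappa}$ or $F=\mathcal{P}$, the final chain of $F$ consists of sets $\nu_iF$ and connecting maps $\nu^{i}_{j}:\nu_iF\to\nu_jF$ ($j\le i$ ordinals), with $\nu_{i+1}F=F(\nu_iF)$ and $\nu^{i+1}_{j+1}=F\nu^{i}_{j}$, while for a limit $i$ (where $0$ counts as a limit) $\nu_iF=\lim_{j<i}\nu_jF$, with $\nu^i_j$ the projections; $\nu_i\mathcal{P}_{<\kappa}\subseteq\nu_i\mathcal{P}$. The elements of all the sets $\nu_i\mathcal{P}$ (elements of different levels being different states) form a transition system, whose transitions are $a\rightsquigarrow b$ for $a\in\nu_{i+1}\mathcal{P}$ and $b\in\nu_{i}\mathcal{P}$ with $b\in a$, and, for a limit $i$, $a\rightsquigarrow b$ for $a,b\in\nu_i\mathcal{P}$ with $b_j\in a_{j+1}$ for all $j<i$. An element $a$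 is $<\!\kappa$-branching if every state reachable from $a$ has fewer than $\kappa$ successors, and $<\!\kappa$-branching at depth $<i$ if every state reachable from $a$ in exactly $m$ steps, for some natural number $m<i$, has fewer than $\kappa$ successors. For a $\mathcal{P}_{<\kappa}$-coalgebra $\zeta:X\to\mathcal{P}_{<\kappa}X$ let $p_i:X\to\nu_i\mathcal{P}_{<\kappa}$ be given by $p_{i+1}(x)=\{p_i(y)\mid y\in\zeta(x)\}$ and $p_i(x)=(p_j(x))_{j<i}$ for a limit $i$; an element of $\nu_i\mathcal{P}_{<\kappa}$ is $\mathcal{P}_{<\kappa}$-coalgebraic if it is of the form $p_i(x)$ for some $\mathcal{P}_{<\kappa}$-coalgebra $(X,\zeta)$ and $x\in X$. Finally, $\kappa$ has the tree property if every inverse chain of sets $(D_i)_{i<\kappa}$ with surjective connecting maps $D_i\to D_j$ ($j\le i$), with $D_0\neq\emptyset$, with $|D_i|<\kappa$ for all $i$, and in which for every limit $i<\kappa$ (including $0$) each full branch through $(D_j)_{j<i}$ extends to at most one full branch through $(D_j)_{j\le i}$, has a full branch. 1. Let $j$ be an ordinal. Every $\mathcal{P}_{<\kappa}$-coalgebraic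 element of $\nu_{\kappa+j}\mathcal{P}_{<\kappa}$ is $<\!\kappa$-branching. Conversely, every $<\!\kappa$-branching element of $\nu_{\kappa+j}\mathcal{P}_{<\kappa}$ is $\mathcal{P}_{<\kappa}$-coalgebraic if and only if $j\ge\omega$ or $\kappa$ has the tree property. 2. Let $j\le i$ be ordinals. Every element of $\nu_{\kappa+j}\mathcal{P}_{<\kappa}$ in the range of $\nu^{\kappa+i}_{\kappa+j}:\nu_{\kappa+i}\mathcal{P}_{<\kappa}\to\nu_{\kappa+j}\mathcal{P}_{<\kappa}$ is $<\!\kappa$-branching at depth $<i$. Conversely, every element of $\nu_{\kappa+j}\mathcal{P}_{<\kappa}$ that is $<\!\kappa$-branching at depth $<i$ is in the range of $\nu^{\kappa+i}_{\kappa+j}$ if and only if $j=i$ or $j\ge\omega$ or $\kappa$ has the tree property. -/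

import Mathlib

open Order

universe u v w

/-! ## Transition systems and branching -/

/-- `StepsTo r m x y`: there is a path of exactly `m` transitions from `x` to `y`. -/
def StepsTo {X : Type v} (r : X → X → Prop) : ℕ → X → X → Prop
  | 0, x, y => x = y
  | m + 1, x, y => ∃ z, r x z ∧ StepsTo r m z y

/-- The state `y` has fewer than `κ` successors. -/
def FewSuccessors {X : Type v} (κ : Cardinal.{u}) (r : X → X → Prop) (y : X) : Prop :=
  Cardinal.lift.{u} (Cardinal.mk {z : X // r y z}) < Cardinal.lift.{v} κ

/-- The pointed system `(X, r, x)` is `<κ`-branching: every state reachable from `x` has fewer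
than `κ` successors. -/
def IsBranching {X : Type v} (κ : Cardinal.{u}) (r : X → X → Prop) (x : X) : Prop :=
  ∀ y, Relation.ReflTransGen r x y → FewSuccessors κ r y

/-- The pointed system `(X, r, x)` is `<κ`-branching at depth `<i`: every state that is reachable
from `x` in exactly `m` steps, for a natural number `m < i`, has fewer than `κ` successors. -/
def IsBranchingAtDepth {X : Type v} (κ : Cardinal.{u}) (i : Ordinal.{u}) (r : X → X → Prop)
    (x : X) : Prop :=
  ∀ m : ℕ, (m : Ordinal.{u}) < i → ∀ y, StepsTo r m x y → FewSuccessors κ r y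

/-! ## Inverse chains and the tree property -/

/-- An inverse `I`-chain (of sets in the universe `w`). -/
structure InverseChain (I : Type v) [LinearOrder I] where
  /-- the levels -/
  obj : I → Type w
  /-- the connecting map from level `i` to level `j`, for `j ≤ i` -/
  map : ∀ {j i : I}, j ≤ i → obj i → obj j
  map_id : ∀ (i : I) (x : obj i), map (le_refl i) x = x
  map_comp : ∀ {k j i : I} (hkj : k ≤ j) (hji : j ≤ i) (x : obj i),
    map hkj (map hji x) = map (hkj.trans hji) x

namespace InverseChain

variable {I : Type v} [LinearOrder I]

/-- `D` has a full branch: a family of elements of all the levels, compatible with the connecting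
maps. -/
def HasFullBranch (D : InverseChain.{v, w} I) : Prop :=
  ∃ x : ∀ i, D.obj i, ∀ (j i : I) (h : j ≤ i), D.map h (x i) = x j

/-- Tidy trees. A least index counts as a limit, so limits are the `IsSuccPrelimit` indices. In
`limit_unique`, the two elements of level `i` have the same images in all the levels `j < i`, i.e.
they extend the same full branch through `(D_j)_{j < i}`. -/
structure IsTidyTree (D : InverseChain.{v, w} I) : Prop where
  surjective : ∀ {j i : I} (h : j ≤ i), Function.Surjective (D.map h)
  limit_unique : ∀ i : I, IsSuccPrelimit i → ∀ x y : D.obj i,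
    (∀ (j : I) (h : j < i), D.map h.le x = D.map h.le y) → x = y
  root : ∀ r : I, IsBot r → Nonempty (D.obj r)

end InverseChain

/-- The tree property of the cardinal `κ`: every tidy `κ`-tree all of whose levels have fewer than
`κ` elements has a full branch. The index set is the set of ordinals less than `κ`. -/
def TreeProperty (κ : Cardinal.{u}) : Prop :=
  ∀ D : InverseChain.{u + 1, u} (Set.Iio κ.ord),
    D.IsTidyTree → (∀ i, Cardinal.mk (D.obj i) < κ) → D.HasFullBranch

/-! ## The final chain of the bounded powerset functor

The levels of the final chain are sets of ZFC sets. A level at a successor ordinal consists of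
subsets of the preceding level, and a level at a limit ordinal `i` (zero counts as a limit)
consists of tuples `(x_j)_{j < i}`, i.e. of functions on the von Neumann ordinal `i`. -/

namespace FinalChain

/-- The tuple `(x_j)_{j < i}`, as a ZFC function on the ordinal `i`. -/
noncomputable def tuple (i : Ordinal.{u}) (x : ∀ j, j < i → ZFSet.{u}) : ZFSet.{u} :=
  ZFSet.range fun j : Set.Iio i => ZFSet.pair j.1.toZFSet (x j.1 j.2)

/-- The component `t_j` of a tuple `t = (t_j)_{j < i}`, where `j < i`. -/
noncomputable def coord (j : Ordinal.{u}) (t : ZFSet.{u}) : ZFSet.{u} :=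
  Classical.epsilon fun y => ZFSet.pair j.toZFSet y ∈ t

/-- The connecting map from level `i` to level `j`; it is meaningful for `j ≤ i`. It is the same
for all the functors `P_{<κ}`.

* If `i` is a limit, it is the projection to the component `j` for `j < i`, and the identity for
  `j = i`.
* From level `i + 1` to level `j + 1` it sends `a` to `{c b | b ∈ a}`, where `c` is the connecting
  map from level `i` to level `j`.
* From level `i + 1` to a limit level `j` it sends `a` to the tuple of the images of `a` in the
  levels `k < j`. -/
noncomputable def conn (j i : Ordinal.{u}) : ZFSet.{u} → ZFSet.{u} :=
  SuccOrder.prelimitRecOn (motive := fun _ => Ordinal.{u} → ZFSet.{u} → ZFSet.{u}) i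
    (fun _ _ c j a =>
      SuccOrder.prelimitRecOn (motive := fun _ => ZFSet.{u}) j
        (fun j' _ _ => ZFSet.range fun b : a => c j' b)
        (fun j _ x => tuple j x))
    (fun i _ _ j a => open Classical in if j < i then coord j a else a)
    j

/-- Level `i` of the final chain of `P_{<κ}`; here `κ` is a cardinal or `⊤`, and `P_{<⊤}` is the
full powerset functor. Level `i + 1` is the set of `<κ`-sized subsets of level `i`, and a limit
level is the limit of the preceding levels, the set of full branches through them. -/
noncomputable def nu (κ : WithTop Cardinal.{u}) (i : Ordinal.{u}) : Set ZFSet.{u} :=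
  SuccOrder.prelimitRecOn (motive := fun _ => Set ZFSet.{u}) i
    (fun _ _ N => {a | (∀ b ∈ a, b ∈ N) ∧ (a.card : WithTop Cardinal.{u}) < κ})
    (fun i _ N => {t | ∃ x : ∀ j, j < i → ZFSet.{u},
      (∀ j hj, x j hj ∈ N j hj) ∧
      (∀ k j (hkj : k ≤ j) (hj : j < i), conn k j (x j hj) = x k (hkj.trans_lt hj)) ∧
      t = tuple i x})

/-- The final chain of `P_{<κ}` is contained in that of the full powerset functor. -/
theorem nu_subset_nu_top (κ : WithTop Cardinal.{u}) (i : Ordinal.{u}) : nu κ i ⊆ nu ⊤ i := by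
  induction i using SuccOrder.prelimitRecOn with
  | succ i hi ih =>
    simp only [nu, SuccOrder.prelimitRecOn_succ] at ih ⊢
    rintro a ⟨h, -⟩
    exact ⟨fun b hb => ih (h b hb), WithTop.coe_lt_top _⟩
  | isSuccPrelimit i hi ih =>
    unfold nu at ih ⊢
    rw [SuccOrder.prelimitRecOn_of_isSuccPrelimit _ _ hi,
      SuccOrder.prelimitRecOn_of_isSuccPrelimit _ _ hi]
    rintro t ⟨x, h, h'⟩
    exact ⟨x, fun j hj => ih j hj (h j hj), h'⟩

/-- The final chain of the full powerset functor as a transition system: the states are the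
elements of all the levels (elements of different levels being different states). -/
def State : Type (u + 1) := {s : Ordinal.{u} × ZFSet.{u} // s.2 ∈ nu ⊤ s.1}

/-- The transition relation from level `i` to level `pred i`: for `a` in level `i + 1` and `b` in
level `i`, there is a transition from `a` to `b` if `b ∈ a`; for a limit `i`, where `pred i = i`,
there is a transition from `a` to `b` if `b_j ∈ a_{j + 1}` for all `j < i`. -/
def Step (s t : State.{u}) : Prop :=
  (s.1.1 = succ t.1.1 ∧ t.1.2 ∈ s.1.2) ∨
  (IsSuccPrelimit s.1.1 ∧ t.1.1 = s.1.1 ∧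
    ∀ j < s.1.1, coord j t.1.2 ∈ coord (succ j) s.1.2)

/-- An element of level `i` of the final chain of `P_{<κ}`, as a state. -/
def toState {κ : WithTop Cardinal.{u}} {i : Ordinal.{u}} (a : nu κ i) : State.{u} :=
  ⟨(i, a.1), nu_subset_nu_top κ i a.2⟩

/-- The `i`-th coalgebra projection of the transition system on `X` in which the set of successors
of `x` is `ζ x`: it sends `x` to `{p_i y | y ∈ ζ x}` at `i + 1`, and to `(p_j x)_{j < i}` at a
limit `i`. -/
noncomputable def proj {X : Type u} (ζ : X → Set X) (i : Ordinal.{u}) : X → ZFSet.{u} :=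
  SuccOrder.prelimitRecOn (motive := fun _ => X → ZFSet.{u}) i
    (fun _ _ p x => ZFSet.range fun y : ζ x => p y)
    (fun i _ p x => tuple i fun j hj => p j hj x)

/-- The element `a` of level `i` is `P_{<κ}`-coalgebraic: it is the projection of a pointed
`P_{<κ}`-coalgebra. -/
def IsCoalgebraic (κ : Cardinal.{u}) (i : Ordinal.{u}) (a : ZFSet.{u}) : Prop :=
  ∃ (X : Type u) (ζ : X → {U : Set X // Cardinal.mk U < κ}) (x : X),
    a = proj (fun y => (ζ y).1) i x

end FinalChain

/-! By regularity, an element of a level from `κ` on is determined by its images below `κ`: given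
fewer than `κ` candidates, if for every `k < κ` some candidate agrees with `c` at `k`, then one
candidate agrees at all `k` (`exists_mem_forall_lt_ord`). So the connecting maps are injective from
`κ` on (`conn_injOn`). The same compactness shows that every successor of the image of some `c` from
level `i + 1` is the image of a member of `c` (`Step.exists_eq_conn`), so such an image has fewer
than `κ` successors. Coalgebraic elements come from all levels, hence are branching; an element from
level `κ + n` allows `n` such steps.

For the converses, the successors of an element of a limit level must recover its components: each
member of a component must extend to a branch. Above `κ` this is automatic, since injectivity makes
any choice of preimages coherent. Hence level `κ + ω` is itself a coalgebra, and all elements from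
there on are coalgebraic. At level `κ` the possible extensions form a tidy tree with levels smaller
than `κ`, so the tree property provides the branch (`exists_mem_limitSucc_of_treeProperty`).

If the tree property fails, a tree without full branch is coded as an element of level `κ` with
nonempty components and no successor (`exists_limitSucc_eq_empty`). It is vacuously branching but
does not come from level `κ + 1`; iterated singletons move the example to level `κ + n`. Coalgebraic
elements do come from every later level, so this one example refutes both converses. -/

namespace FinalChain

/-! ## Basic facts on the connecting maps -/

theorem pair_mem_tuple {i : Ordinal.{u}} {x : ∀ j, j < i → ZFSet.{u}} {j : Ordinal.{u}} (hj : j < i)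
    {y : ZFSet.{u}} : ZFSet.pair j.toZFSet y ∈ tuple i x ↔ y = x j hj := by
  simp only [tuple, ZFSet.mem_range, ZFSet.pair_inj, Subtype.exists, Set.mem_Iio]
  constructor
  · rintro ⟨k, hk, h, rfl⟩
    obtain rfl := Ordinal.toZFSet_injective h
    rfl
  · rintro rfl
    exact ⟨j, hj, rfl, rfl⟩

theorem coord_tuple {i : Ordinal.{u}} (x : ∀ j, j < i → ZFSet.{u}) {j : Ordinal.{u}} (hj : j < i) :
    coord j (tuple i x) = x j hj := by
  simp only [coord, pair_mem_tuple hj, Classical.epsilon_singleton]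

theorem tuple_congr {i : Ordinal.{u}} {x y : ∀ j, j < i → ZFSet.{u}}
    (h : ∀ j hj, x j hj = y j hj) : tuple i x = tuple i y := by
  congr 1
  funext j hj
  exact h j hj

theorem conn_limit {i : Ordinal.{u}} (hi : IsSuccPrelimit i) {j : Ordinal.{u}} (hj : j < i)
    (a : ZFSet.{u}) : conn j i a = coord j a := by
  rw [conn, SuccOrder.prelimitRecOn_of_isSuccPrelimit _ _ hi, if_pos hj]

theorem conn_succ_succ (j i : Ordinal.{u}) (a : ZFSet.{u}) :
    conn (succ j) (succ i) a = ZFSet.range fun b : a => conn j i b := by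
  rw [conn, SuccOrder.prelimitRecOn_succ, SuccOrder.prelimitRecOn_succ]
  rfl

theorem mem_conn_succ_succ {j i : Ordinal.{u}} {a c : ZFSet.{u}} :
    c ∈ conn (succ j) (succ i) a ↔ ∃ b ∈ a, conn j i b = c := by
  rw [conn_succ_succ, ZFSet.mem_range]
  simp

theorem conn_limit_succ {j : Ordinal.{u}} (hj : IsSuccPrelimit j) (i : Ordinal.{u})
    (a : ZFSet.{u}) : conn j (succ i) a = tuple j fun k _ => conn k (succ i) a := by
  simp only [conn, SuccOrder.prelimitRecOn_succ]
  rw [SuccOrder.prelimitRecOn_of_isSuccPrelimit _ _ hj]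

theorem conn_self (i : Ordinal.{u}) (a : ZFSet.{u}) : conn i i a = a := by
  induction i using SuccOrder.prelimitRecOn generalizing a with
  | succ i hi ih =>
    ext c
    rw [mem_conn_succ_succ]
    simp [ih]
  | isSuccPrelimit i hi ih =>
    rw [conn, SuccOrder.prelimitRecOn_of_isSuccPrelimit _ _ hi, if_neg (lt_irrefl i)]

theorem mem_nu_succ {κ : WithTop Cardinal.{u}} {i : Ordinal.{u}} {a : ZFSet.{u}} :
    a ∈ nu κ (succ i) ↔ (∀ b ∈ a, b ∈ nu κ i) ∧ (a.card : WithTop Cardinal.{u}) < κ := by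
  rw [nu, SuccOrder.prelimitRecOn_succ]
  rfl

theorem mem_nu_limit {κ : WithTop Cardinal.{u}} {i : Ordinal.{u}} (hi : IsSuccPrelimit i)
    {a : ZFSet.{u}} : a ∈ nu κ i ↔ ∃ x : ∀ j, j < i → ZFSet.{u},
      (∀ j hj, x j hj ∈ nu κ j) ∧
      (∀ k j (hkj : k ≤ j) (hj : j < i), conn k j (x j hj) = x k (hkj.trans_lt hj)) ∧
      a = tuple i x := by
  rw [nu, SuccOrder.prelimitRecOn_of_isSuccPrelimit _ _ hi]
  rfl

theorem card_range_le {α : Type (u + 1)} [Small.{u} α] (f : α → ZFSet.{u}) {a : ZFSet.{u}}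
    (g : α → a) (hg : Function.Injective g) : (ZFSet.range f).card ≤ a.card := by
  have h1 := ZFSet.lift_card_range_le (f := f)
  have h2 : Cardinal.mk α ≤ Cardinal.mk a := Cardinal.mk_le_of_injective hg
  rw [ZFSet.cardinalMk_coe_sort] at h2
  rw [← Cardinal.lift_le.{u + 1}]
  rw [Cardinal.lift_id'.{u, u + 1}] at h1
  exact h1.trans h2

theorem card_conn_succ_succ_le (j i : Ordinal.{u}) (a : ZFSet.{u}) :
    (conn (succ j) (succ i) a).card ≤ a.card := by
  rw [conn_succ_succ]
  exact card_range_le _ id Function.injective_id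

/-- The two claims need a joint induction: membership in a limit level is itself a compatibility
statement about the lower images. -/
theorem conn_mem_and_conn_conn {κ : WithTop Cardinal.{u}} {i : Ordinal.{u}} : ∀ {a : ZFSet.{u}},
    a ∈ nu κ i → ∀ {j : Ordinal.{u}}, j ≤ i →
      conn j i a ∈ nu κ j ∧ ∀ k ≤ j, conn k j (conn j i a) = conn k i a := by
  induction i using SuccOrder.prelimitRecOn with
  | isSuccPrelimit i hi ih =>
    intro a ha j hj
    rcases hj.eq_or_lt with rfl | hj
    · simp [conn_self, ha]
    obtain ⟨x, hx, hxx, rfl⟩ := (mem_nu_limit hi).1 ha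
    rw [conn_limit hi hj, coord_tuple _ hj]
    refine ⟨hx j hj, fun k hk => ?_⟩
    rw [hxx k j hk hj, conn_limit hi (hk.trans_lt hj), coord_tuple _ (hk.trans_lt hj)]
  | succ i _ ih =>
    intro a ha j hj
    rw [mem_nu_succ] at ha
    have key (j) (hj : succ j ≤ succ i) : ∀ k ≤ succ j,
        conn k (succ j) (conn (succ j) (succ i) a) = conn k (succ i) a := by
      intro k hk
      induction k using SuccOrder.prelimitRecOn with
      | succ k _ _ =>
        ext c
        simp only [mem_conn_succ_succ]
        constructor
        · rintro ⟨_, ⟨b, hb, rfl⟩, rfl⟩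
          exact ⟨b, hb, ((ih (ha.1 b hb) (succ_le_succ_iff.1 hj)).2 k
            (succ_le_succ_iff.1 hk)).symm⟩
        · rintro ⟨b, hb, rfl⟩
          exact ⟨_, ⟨b, hb, rfl⟩, (ih (ha.1 b hb) (succ_le_succ_iff.1 hj)).2 k
            (succ_le_succ_iff.1 hk)⟩
      | isSuccPrelimit k hk' ihk =>
        rw [conn_limit_succ hk', conn_limit_succ hk']
        exact tuple_congr fun l hl => ihk l hl (hl.le.trans hk)
    induction j using SuccOrder.prelimitRecOn with
    | succ j _ _ =>
      refine ⟨?_, key j hj⟩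
      rw [mem_nu_succ]
      refine ⟨fun c hc => ?_, ?_⟩
      · obtain ⟨b, hb, rfl⟩ := mem_conn_succ_succ.1 hc
        exact (ih (ha.1 b hb) (succ_le_succ_iff.1 hj)).1
      · exact (WithTop.coe_le_coe.2 (card_conn_succ_succ_le j i a)).trans_lt ha.2
    | isSuccPrelimit j hj' ihj =>
      constructor
      · rw [conn_limit_succ hj', mem_nu_limit hj']
        exact ⟨_, fun k hk => (ihj k hk (hk.le.trans hj)).1,
          fun k l hkl hl => (ihj l hl (hl.le.trans hj)).2 k hkl, rfl⟩
      · intro k hk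
        rcases hk.eq_or_lt with rfl | hk
        · rw [conn_self]
        · rw [conn_limit hj' hk, conn_limit_succ hj', coord_tuple _ hk]

theorem conn_mem {κ : WithTop Cardinal.{u}} {i j : Ordinal.{u}} {a : ZFSet.{u}} (ha : a ∈ nu κ i)
    (hj : j ≤ i) : conn j i a ∈ nu κ j :=
  (conn_mem_and_conn_conn ha hj).1

theorem conn_conn {κ : WithTop Cardinal.{u}} {i j k : Ordinal.{u}} {a : ZFSet.{u}} (ha : a ∈ nu κ i)
    (hj : j ≤ i) (hk : k ≤ j) : conn k j (conn j i a) = conn k i a :=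
  (conn_mem_and_conn_conn ha hj).2 k hk

theorem eq_tuple_conn {κ : WithTop Cardinal.{u}} {i : Ordinal.{u}} (hi : IsSuccPrelimit i)
    {a : ZFSet.{u}} (ha : a ∈ nu κ i) : a = tuple i fun j _ => conn j i a := by
  obtain ⟨x, hx, hxx, rfl⟩ := (mem_nu_limit hi).1 ha
  exact tuple_congr fun j hj => by rw [conn_limit hi hj, coord_tuple _ hj]

theorem conn_tuple {i j : Ordinal.{u}} (hi : IsSuccPrelimit i) (x : ∀ j, j < i → ZFSet.{u})
    (hj : j < i) : conn j i (tuple i x) = x j hj := by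
  rw [conn_limit hi hj, coord_tuple _ hj]

theorem nu_limit_ext {κ κ' : WithTop Cardinal.{u}} {i : Ordinal.{u}} (hi : IsSuccPrelimit i)
    {a b : ZFSet.{u}} (ha : a ∈ nu κ i) (hb : b ∈ nu κ' i)
    (h : ∀ j < i, conn j i a = conn j i b) : a = b := by
  rw [eq_tuple_conn hi ha, eq_tuple_conn hi hb]
  exact tuple_congr h

theorem mem_nu_limit_of_conn {κ κ' : WithTop Cardinal.{u}} {i : Ordinal.{u}}
    (hi : IsSuccPrelimit i) {a : ZFSet.{u}} (ha : a ∈ nu κ i)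
    (h : ∀ j < i, conn j i a ∈ nu κ' j) : a ∈ nu κ' i :=
  (mem_nu_limit hi).2 ⟨fun j _ => conn j i a, h,
    fun _ _ hkj hj => conn_conn ha hj.le hkj, eq_tuple_conn hi ha⟩

theorem mem_conn_of_conn {κ : WithTop Cardinal.{u}} {i j k : Ordinal.{u}} {a b : ZFSet.{u}}
    (ha : a ∈ nu κ i) (hj : succ j ≤ i) (hk : k ≤ j) :
    b ∈ conn (succ k) i a ↔ ∃ c ∈ conn (succ j) i a, conn k j c = b := by
  rw [← conn_conn ha hj (succ_le_succ hk), mem_conn_succ_succ]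

/-- Allows sets of elements of a level to serve as carriers of coalgebras in `Type u`. -/
theorem small_nu (κ : WithTop Cardinal.{u}) (i : Ordinal.{u}) : Small.{u} (nu κ i) := by
  induction i using SuccOrder.prelimitRecOn with
  | succ i _ ih =>
    have : nu κ (succ i) ⊆ (ZFSet.powerset (ZFSet.range fun b : nu κ i => b.1) : ZFSet.{u}) := by
      intro a ha
      rw [mem_nu_succ] at ha
      simp only [SetLike.mem_coe, ZFSet.mem_powerset]
      intro b hb
      exact ZFSet.mem_range.2 ⟨⟨b, ha.1 b hb⟩, rfl⟩
    exact @small_subset _ _ _ this (ZFSet.small_coe _)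
  | isSuccPrelimit i hi ih =>
    have h (j : Set.Iio i) : Small.{u} (nu κ j.1) := ih j.1 j.2
    have : nu κ i ⊆ Set.range fun x : (∀ j : Set.Iio i, nu κ j.1) =>
        tuple i fun j hj => (x ⟨j, hj⟩).1 := by
      intro a ha
      obtain ⟨x, hx, -, rfl⟩ := (mem_nu_limit hi).1 ha
      exact ⟨fun j => ⟨x j.1 j.2, hx j.1 j.2⟩, rfl⟩
    exact small_subset this

/-! ## Separation by the levels below `κ` -/

theorem isSuccPrelimit_ord {κ : Cardinal.{u}} (hκ : κ.IsRegular) : IsSuccPrelimit κ.ord :=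
  (Cardinal.isSuccLimit_ord hκ.aleph0_le).isSuccPrelimit

/-- If every `d ∈ c` failed at some `f d < κ`, the supremum of the `f d` would still be below `κ`,
and an element good at the supremum would be good at its own `f d`. -/
theorem exists_mem_forall_lt_ord {κ : Cardinal.{u}} (hκ : κ.IsRegular) {c : ZFSet.{u}}
    (hc : c.card < κ) {R : Ordinal.{u} → ZFSet.{u} → Prop}
    (hR : ∀ k l d, d ∈ c → l ≤ k → k < κ.ord → R k d → R l d)
    (h : ∀ k < κ.ord, ∃ d ∈ c, R k d) :
    ∃ d ∈ c, ∀ k < κ.ord, R k d := by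
  by_contra! H
  choose! f hf hfR using H
  have hs : ⨆ d : c, f d < κ.ord := by
    apply Ordinal.lift_iSup_lt_of_lt_cof
    · rw [ZFSet.cardinalMk_coe_sort, ← Ordinal.lift_cof, hκ.cof_ord]
      simpa using hc
    · exact fun d => hf d.1 d.2
  obtain ⟨d, hd, hdR⟩ := h _ hs
  refine hfR d hd (hR _ _ d hd ?_ hs hdR)
  exact le_ciSup (Ordinal.bddAbove_of_small (s := Set.range fun d : c => f d)) (⟨d, hd⟩ : c)

/-- At a successor level, each `c ∈ a` is matched at every `k < κ` by some member of `b`; one member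
matches at all `k`, and it equals `c` by induction. -/
theorem nu_ext {κ : Cardinal.{u}} (hκ : κ.IsRegular) {i : Ordinal.{u}} (hi : κ.ord ≤ i) :
    ∀ {a b : ZFSet.{u}}, a ∈ nu κ i → b ∈ nu κ i →
      (∀ k < κ.ord, conn k i a = conn k i b) → a = b := by
  induction i using SuccOrder.prelimitRecOn with
  | isSuccPrelimit i hi' ih =>
    intro a b ha hb h
    refine nu_limit_ext hi' ha hb fun j hj => ?_
    rcases lt_or_ge j κ.ord with hjκ | hjκ
    · exact h j hjκ
    · refine ih j hj hjκ (conn_mem ha hj.le) (conn_mem hb hj.le) fun k hk => ?_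
      rw [conn_conn ha hj.le (hk.le.trans hjκ), conn_conn hb hj.le (hk.le.trans hjκ), h k hk]
  | succ i _ ih =>
    have hi' : κ.ord ≤ i := by
      rcases hi.eq_or_lt with h | h
      · exact absurd h ((isSuccPrelimit_ord hκ).succ_ne i).symm
      · exact lt_succ_iff.1 h
    have key : ∀ {a b : ZFSet.{u}}, a ∈ nu κ (succ i) → b ∈ nu κ (succ i) →
        (∀ k < κ.ord, conn k (succ i) a = conn k (succ i) b) → ∀ c ∈ a, c ∈ b := by
      intro a b ha hb h c hca
      have hc := (mem_nu_succ.1 ha).1 c hca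
      obtain ⟨d, hd, hdc⟩ := exists_mem_forall_lt_ord hκ (WithTop.coe_lt_coe.1 (mem_nu_succ.1 hb).2)
        (R := fun k d => conn k i d = conn k i c) (by
          intro k l d hd hl hk hkd
          have hd := (mem_nu_succ.1 hb).1 d hd
          rw [← conn_conn hd (hk.le.trans hi') hl, hkd, conn_conn hc (hk.le.trans hi') hl]) (by
          intro k hk
          rw [← mem_conn_succ_succ, ← h _ ((isSuccPrelimit_ord hκ).succ_lt hk), mem_conn_succ_succ]
          exact ⟨c, hca, rfl⟩)
      obtain rfl := ih hi' hc ((mem_nu_succ.1 hb).1 d hd) fun k hk => (hdc k hk).symm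
      exact hd
    intro a b ha hb h
    ext c
    exact ⟨key ha hb h c, key hb ha (fun k hk => (h k hk).symm) c⟩

theorem conn_injOn {κ : Cardinal.{u}} (hκ : κ.IsRegular) {i j : Ordinal.{u}} (hj : κ.ord ≤ j)
    (hji : j ≤ i) : Set.InjOn (conn j i) (nu κ i) := by
  intro a ha b hb h
  refine nu_ext hκ (hj.trans hji) ha hb fun k hk => ?_
  rw [← conn_conn ha hji (hk.le.trans hj), h, conn_conn hb hji (hk.le.trans hj)]

/-- The transitions at a limit level from an element that comes from the next level. -/
theorem exists_mem_conn_eq {κ : Cardinal.{u}} (hκ : κ.IsRegular) {i j : Ordinal.{u}}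
    (hj : κ.ord ≤ j) (hj' : IsSuccPrelimit j) (hji : j ≤ i) {b c : ZFSet.{u}}
    (hc : c ∈ nu κ (succ i)) (hb : b ∈ nu ⊤ j)
    (h : ∀ k < j, conn k j b ∈ conn (succ k) (succ i) c) : ∃ d ∈ c, conn j i d = b := by
  have hc' := mem_nu_succ.1 hc
  simp only [mem_conn_succ_succ] at h
  obtain ⟨d, hd, hdb⟩ := exists_mem_forall_lt_ord hκ (WithTop.coe_lt_coe.1 hc'.2)
    (R := fun k d => conn k i d = conn k j b) (by
      intro k l d hd hl hk hkd
      rw [← conn_conn (hc'.1 d hd) ((hk.le.trans hj).trans hji) hl, hkd,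
        conn_conn hb (hk.le.trans hj) hl])
    (fun k hk => h k (hk.trans_le hj))
  -- A priori `b` lies only in the chain of the full powerset, but its components are images of
  -- members of `c`.
  have hbκ : b ∈ nu κ j := by
    refine mem_nu_limit_of_conn hj' hb fun k hk => ?_
    obtain ⟨e, he, heb⟩ := h k hk
    rw [← heb]
    exact conn_mem (hc'.1 e he) (hk.le.trans hji)
  refine ⟨d, hd, nu_ext hκ hj (conn_mem (hc'.1 d hd) hji) hbκ fun k hk => ?_⟩
  rw [conn_conn (hc'.1 d hd) hji (hk.le.trans hj), hdb k hk]

/-! ## Coalgebra projections -/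

section proj

variable {X : Type u} (ζ : X → Set X)

theorem mem_proj_succ {i : Ordinal.{u}} {x : X} {c : ZFSet.{u}} :
    c ∈ proj ζ (succ i) x ↔ ∃ y ∈ ζ x, proj ζ i y = c := by
  rw [proj, SuccOrder.prelimitRecOn_succ, ZFSet.mem_range]
  simp only [Subtype.exists, exists_prop]
  rfl

theorem proj_limit {i : Ordinal.{u}} (hi : IsSuccPrelimit i) (x : X) :
    proj ζ i x = tuple i fun j _ => proj ζ j x := by
  rw [proj, SuccOrder.prelimitRecOn_of_isSuccPrelimit _ _ hi]
  rfl

theorem conn_proj {i j : Ordinal.{u}} (hj : j ≤ i) (x : X) :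
    conn j i (proj ζ i x) = proj ζ j x := by
  induction i using SuccOrder.prelimitRecOn generalizing j x with
  | isSuccPrelimit i hi ih =>
    rcases hj.eq_or_lt with rfl | hj
    · exact conn_self _ _
    · rw [proj_limit ζ hi, conn_tuple hi _ hj]
  | succ i _ ih =>
    induction j using SuccOrder.prelimitRecOn with
    | isSuccPrelimit j hj' ihj =>
      rw [conn_limit_succ hj', proj_limit ζ hj']
      exact tuple_congr fun k hk => ihj k hk (hk.le.trans hj)
    | succ j _ _ =>
      ext c
      simp only [mem_conn_succ_succ, mem_proj_succ]
      constructor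
      · rintro ⟨_, ⟨y, hy, rfl⟩, rfl⟩
        exact ⟨y, hy, (ih (succ_le_succ_iff.1 hj) y).symm⟩
      · rintro ⟨y, hy, rfl⟩
        exact ⟨_, ⟨y, hy, rfl⟩, ih (succ_le_succ_iff.1 hj) y⟩

theorem proj_mem_nu {κ : Cardinal.{u}} (hζ : ∀ x, Cardinal.mk (ζ x) < κ) (i : Ordinal.{u}) (x : X) :
    proj ζ i x ∈ nu κ i := by
  induction i using SuccOrder.prelimitRecOn generalizing x with
  | isSuccPrelimit i hi ih =>
    rw [mem_nu_limit hi, proj_limit ζ hi]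
    exact ⟨_, fun j hj => ih j hj x, fun k j hkj hj => conn_proj ζ hkj x, rfl⟩
  | succ i _ ih =>
    rw [mem_nu_succ]
    constructor
    · intro b hb
      obtain ⟨y, -, rfl⟩ := (mem_proj_succ ζ).1 hb
      exact ih y
    · rw [WithTop.coe_lt_coe]
      refine lt_of_le_of_lt ?_ (hζ x)
      rw [proj, SuccOrder.prelimitRecOn_succ]
      exact Cardinal.lift_le.1 ZFSet.lift_card_range_le

end proj

theorem IsCoalgebraic.conn {κ : Cardinal.{u}} {i j : Ordinal.{u}} {a : ZFSet.{u}}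
    (ha : IsCoalgebraic κ i a) (hj : j ≤ i) : IsCoalgebraic κ j (conn j i a) := by
  obtain ⟨X, ζ, x, rfl⟩ := ha
  exact ⟨X, ζ, x, conn_proj _ hj x⟩

theorem IsCoalgebraic.exists_conn_eq {κ : Cardinal.{u}} {i j : Ordinal.{u}} {a : ZFSet.{u}}
    (ha : IsCoalgebraic κ j a) (hj : j ≤ i) :
    ∃ c ∈ nu κ i, IsCoalgebraic κ i c ∧ FinalChain.conn j i c = a := by
  obtain ⟨X, ζ, x, rfl⟩ := ha
  exact ⟨_, proj_mem_nu _ (fun y => (ζ y).2) i x, ⟨X, ζ, x, rfl⟩, conn_proj _ hj x⟩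

/-- The coalgebra provides a lift of the image to level `i`; by injectivity that lift is `a`. -/
theorem isCoalgebraic_of_conn {κ : Cardinal.{u}} (hκ : κ.IsRegular) {i j : Ordinal.{u}}
    {a : ZFSet.{u}} (hj : κ.ord ≤ j) (hji : j ≤ i) (ha : a ∈ nu κ i)
    (h : IsCoalgebraic κ j (conn j i a)) : IsCoalgebraic κ i a := by
  obtain ⟨c, hc, hc', hca⟩ := h.exists_conn_eq hji
  rwa [← conn_injOn hκ hj hji hc ha hca]

/-- A set `S` of elements of a limit level that is a coalgebra in a compatible way consists of
coalgebraic elements. -/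
theorem isCoalgebraic_of_subcoalgebra {κ : Cardinal.{u}} {i : Ordinal.{u}} (S : Set ZFSet.{u})
    (hS : S ⊆ nu κ i) (E : ZFSet.{u} → Set ZFSet.{u})
    (hE : ∀ a ∈ S, E a ⊆ S) (hcard : ∀ a ∈ S, Cardinal.mk (E a) < Cardinal.lift.{u + 1} κ)
    (h : ∀ a ∈ S, ∀ k < i, ∀ c, c ∈ conn (succ k) i a ↔ ∃ b ∈ E a, conn k i b = c)
    {a : ZFSet.{u}} (ha : a ∈ S) : IsCoalgebraic κ i a := by
  have _ : Small.{u} (nu (κ : WithTop Cardinal.{u}) i) := small_nu _ _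
  have _ : Small.{u} S := small_subset hS
  let e := equivShrink S
  let ζ : Shrink.{u} S → Set (Shrink.{u} S) := fun x => {y | (e.symm y).1 ∈ E (e.symm x).1}
  have hζ (x) : Cardinal.mk (ζ x) < κ := by
    rw [← Cardinal.lift_lt.{u, u + 1} (b := κ)]
    refine lt_of_le_of_lt ?_ (hcard _ (e.symm x).2)
    have := Cardinal.lift_mk_le_lift_mk_of_injective
      (f := fun y : ζ x => (⟨(e.symm y.1).1, y.2⟩ : E (e.symm x).1)) fun y z hyz => by
        exact Subtype.ext (e.symm.injective (Subtype.ext (congrArg (fun w : E (e.symm x).1 => w.1) hyz)))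
    rwa [Cardinal.lift_id'.{u, u + 1}] at this
  -- The projections of the coalgebra `S` are the connecting maps, so the one to level `i` is the
  -- inclusion.
  have hp : ∀ k ≤ i, ∀ x, proj ζ k x = conn k i (e.symm x).1 := by
    intro k
    induction k using SuccOrder.prelimitRecOn with
    | isSuccPrelimit k hk ih =>
      intro hki x
      have hx := hS (e.symm x).2
      rw [proj_limit ζ hk, eq_tuple_conn hk (conn_mem hx hki)]
      exact tuple_congr fun j hj => by rw [ih j hj (hj.le.trans hki), conn_conn hx hki hj.le]
    | succ k _ ih =>
      intro hki x
      have hk := (lt_succ k).trans_le hki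
      ext c
      rw [mem_proj_succ, h _ (e.symm x).2 k hk]
      constructor
      · rintro ⟨y, hy, rfl⟩
        exact ⟨_, hy, (ih hk.le y).symm⟩
      · rintro ⟨b, hb, rfl⟩
        refine ⟨e ⟨b, hE _ (e.symm x).2 hb⟩, ?_, ?_⟩
        · simpa [ζ] using hb
        · rw [ih hk.le]
          simp
  refine ⟨Shrink.{u} S, fun x => ⟨ζ x, hζ x⟩, e ⟨a, ha⟩, ?_⟩
  rw [hp i le_rfl]
  simp [conn_self]

end FinalChain

/-! ## Branching -/

section branching

variable {X : Type v} {κ : Cardinal.{u}} {r : X → X → Prop} {x : X}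

theorem isBranching_iff :
    IsBranching κ r x ↔ FewSuccessors κ r x ∧ ∀ y, r x y → IsBranching κ r y := by
  constructor
  · exact fun h => ⟨h x .refl, fun y hy z hz => h z (.head hy hz)⟩
  · rintro ⟨h, h'⟩ y hy
    rcases hy.cases_head with rfl | ⟨z, hz, hzy⟩
    · exact h
    · exact h' z hz y hzy

theorem isBranchingAtDepth_succ_iff {n : ℕ} : IsBranchingAtDepth κ (n + 1 : ℕ) r x ↔
    FewSuccessors κ r x ∧ ∀ y, r x y → IsBranchingAtDepth κ n r y := by
  constructor
  · refine fun h => ⟨h 0 (by exact_mod_cast Nat.succ_pos n) x rfl, fun y hy m hm z hz => ?_⟩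
    exact h (m + 1) (by exact_mod_cast Nat.succ_lt_succ (Nat.cast_lt.1 hm)) z ⟨y, hy, hz⟩
  · rintro ⟨h, h'⟩ m hm y hy
    cases m with
    | zero => exact hy ▸ h
    | succ m =>
      obtain ⟨z, hz, hzy⟩ := hy
      exact h' z hz m (by exact_mod_cast Nat.lt_of_succ_lt_succ (Nat.cast_lt.1 hm)) y hzy

theorem StepsTo.reflTransGen {m : ℕ} {x y : X} (h : StepsTo r m x y) :
    Relation.ReflTransGen r x y := by
  induction m generalizing x with
  | zero => exact (show x = y from h) ▸ .refl
  | succ m ih =>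
    obtain ⟨z, hz, hzy⟩ := h
    exact .head hz (ih hzy)

theorem exists_stepsTo {x y : X} (h : Relation.ReflTransGen r x y) : ∃ m, StepsTo r m x y := by
  induction h using Relation.ReflTransGen.head_induction_on with
  | refl => exact ⟨0, rfl⟩
  | head h _ ih =>
    obtain ⟨m, hm⟩ := ih
    exact ⟨m + 1, _, h, hm⟩

theorem IsBranching.isBranchingAtDepth (h : IsBranching κ r x) (i : Ordinal.{u}) :
    IsBranchingAtDepth κ i r x :=
  fun _ _ y hy => h y hy.reflTransGen

theorem IsBranchingAtDepth.isBranching {i : Ordinal.{u}} (h : IsBranchingAtDepth κ i r x)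
    (hi : Ordinal.omega0 ≤ i) : IsBranching κ r x := by
  intro y hy
  obtain ⟨m, hm⟩ := exists_stepsTo hy
  exact h m ((Ordinal.natCast_lt_omega0 m).trans_le hi) y hm

end branching

namespace FinalChain

/-! ## Transitions between the levels -/

theorem Step.level_eq {s t t' : State.{u}} (h : Step s t) (h' : Step s t') : t.1.1 = t'.1.1 := by
  rcases h with ⟨h, -⟩ | ⟨hl, h, -⟩ <;> rcases h' with ⟨h', -⟩ | ⟨hl', h', -⟩
  · exact succ_injective (h.symm.trans h')
  · exact absurd h.symm (hl'.succ_ne _)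
  · exact absurd h'.symm (hl.succ_ne _)
  · exact h.trans h'.symm

theorem step_succ_iff {s t : State.{u}} {i : Ordinal.{u}} (hs : s.1.1 = succ i) :
    Step s t ↔ t.1.1 = i ∧ t.1.2 ∈ s.1.2 := by
  constructor
  · rintro (⟨h, h'⟩ | ⟨hl, -, -⟩)
    · exact ⟨succ_injective (h.symm.trans hs), h'⟩
    · exact absurd hs.symm (hl.succ_ne _)
  · rintro ⟨rfl, h⟩
    exact .inl ⟨hs, h⟩

/-- The successors of an element `a` of a limit level `i`. -/
def limitSucc (i : Ordinal.{u}) (a : ZFSet.{u}) : Set ZFSet.{u} :=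
  {b | b ∈ nu ⊤ i ∧ ∀ j < i, conn j i b ∈ conn (succ j) i a}

theorem step_limit_iff {s t : State.{u}} {i : Ordinal.{u}} (hi : IsSuccPrelimit i)
    (hs : s.1.1 = i) : Step s t ↔ t.1.1 = i ∧ t.1.2 ∈ limitSucc i s.1.2 := by
  have key : (∀ j < i, coord j t.1.2 ∈ coord (succ j) s.1.2) ↔
      ∀ j < i, conn j i t.1.2 ∈ conn (succ j) i s.1.2 := by
    refine forall₂_congr fun j hj => ?_
    rw [conn_limit hi hj, conn_limit hi (hi.succ_lt hj)]
  subst hs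
  constructor
  · rintro (⟨h, -⟩ | ⟨-, h, h'⟩)
    · exact absurd h.symm (hi.succ_ne _)
    · exact ⟨h, h ▸ t.2, key.1 h'⟩
  · rintro ⟨h, -, h'⟩
    exact .inr ⟨hi, h, key.2 h'⟩

theorem fewSuccessors_of_subset {κ : Cardinal.{u}} {s : State.{u}} (E : Set ZFSet.{u})
    (hE : Cardinal.mk E < Cardinal.lift.{u + 1} κ) (h : ∀ t, Step s t → t.1.2 ∈ E) :
    FewSuccessors κ Step s := by
  rw [FewSuccessors, Cardinal.lift_id'.{u, u + 1}]
  refine lt_of_le_of_lt ?_ hE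
  refine Cardinal.mk_le_of_injective (f := fun t : {t // Step s t} => (⟨_, h t.1 t.2⟩ : E)) ?_
  intro t t' htt'
  exact Subtype.ext (Subtype.ext (Prod.ext (t.2.level_eq t'.2)
    (congrArg (fun b : E => b.1) htt')))

theorem mk_limitSucc_lt {κ : Cardinal.{u}} {s : State.{u}} (hs : IsSuccPrelimit s.1.1)
    (h : FewSuccessors κ Step s) :
    Cardinal.mk (limitSucc s.1.1 s.1.2) < Cardinal.lift.{u + 1} κ := by
  rw [FewSuccessors, Cardinal.lift_id'.{u, u + 1}] at h
  refine lt_of_le_of_lt ?_ h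
  refine Cardinal.mk_le_of_injective (f := fun b : limitSucc s.1.1 s.1.2 =>
    (⟨⟨(s.1.1, b.1), b.2.1⟩, (step_limit_iff hs rfl).2 ⟨rfl, b.2⟩⟩ : {t // Step s t})) ?_
  intro b b' hbb'
  exact Subtype.ext (congrArg (fun t : {t // Step s t} => t.1.1.2) hbb')

theorem limitSucc_subset {κ : WithTop Cardinal.{u}} {i : Ordinal.{u}} (hi : IsSuccPrelimit i)
    {a : ZFSet.{u}} (ha : a ∈ nu κ i) : limitSucc i a ⊆ nu κ i :=
  fun _ hb => mem_nu_limit_of_conn hi hb.1 fun j hj =>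
    (mem_nu_succ.1 (conn_mem ha (hi.succ_lt hj).le)).1 _ (hb.2 j hj)

theorem mk_coe_lt {κ : Cardinal.{u}} {i : Ordinal.{u}} {a : ZFSet.{u}} (ha : a ∈ nu κ (succ i)) :
    Cardinal.mk (a : Set ZFSet.{u}) < Cardinal.lift.{u + 1} κ := by
  have := (mem_nu_succ.1 ha).2
  rw [WithTop.coe_lt_coe, ← Cardinal.lift_lt.{u, u + 1}] at this
  exact ZFSet.cardinalMk_coe_sort.trans_lt this

/-- A successor is determined by its component at `κ`, which belongs to the component of `a` at `κ +
1`, a set of fewer than `κ` elements. -/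
theorem mk_limitSucc_lt_of_lt {κ : Cardinal.{u}} (hκ : κ.IsRegular) {i : Ordinal.{u}}
    (hi : IsSuccPrelimit i) (hκi : κ.ord < i) {a : ZFSet.{u}} (ha : a ∈ nu κ i) :
    Cardinal.mk (limitSucc i a) < Cardinal.lift.{u + 1} κ := by
  refine lt_of_le_of_lt ?_ (mk_coe_lt (conn_mem ha (hi.succ_lt hκi).le))
  refine Cardinal.mk_le_of_injective (f := fun b : limitSucc i a =>
    (⟨_, b.2.2 _ hκi⟩ : (conn (succ κ.ord) i a : Set ZFSet.{u}))) fun b b' h => ?_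
  exact Subtype.ext (conn_injOn hκ le_rfl hκi.le (limitSucc_subset hi ha b.2)
    (limitSucc_subset hi ha b'.2) (congrArg (fun c : (conn _ _ _ : Set ZFSet.{u}) => c.1) h))

theorem fewSuccessors_of_succ {κ : Cardinal.{u}} {s : State.{u}} {i : Ordinal.{u}}
    (hs : s.1.1 = succ i) (h : s.1.2 ∈ nu κ (succ i)) : FewSuccessors κ Step s :=
  fewSuccessors_of_subset _ (mk_coe_lt h) fun _ ht => ((step_succ_iff hs).1 ht).2

/-- The transitions from an element that comes from the level `succ i`. -/
theorem Step.exists_eq_conn {κ : Cardinal.{u}} (hκ : κ.IsRegular) {i : Ordinal.{u}} {c : ZFSet.{u}}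
    (hc : c ∈ nu κ (succ i)) {s t : State.{u}} (hκs : κ.ord ≤ s.1.1) (hs : s.1.1 ≤ succ i)
    (hsc : s.1.2 = conn s.1.1 (succ i) c) (h : Step s t) :
    κ.ord ≤ t.1.1 ∧ t.1.1 ≤ i ∧ ∃ d ∈ c, t.1.2 = conn t.1.1 i d := by
  rcases em (IsSuccPrelimit s.1.1) with hl | hl
  · have ht := (step_limit_iff hl rfl).1 h
    have hsi : s.1.1 ≤ i := by
      rcases hs.eq_or_lt with h | h
      · exact absurd h.symm (hl.succ_ne i)
      · exact lt_succ_iff.1 h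
    rw [ht.1]
    refine ⟨hκs, hsi, ?_⟩
    obtain ⟨d, hd, hdt⟩ := exists_mem_conn_eq hκ hκs hl hsi hc ht.2.1 fun k hk => by
      have := ht.2.2 k hk
      rwa [hsc, conn_conn hc hs (hl.succ_lt hk).le] at this
    exact ⟨d, hd, hdt.symm⟩
  · obtain ⟨j, hj⟩ := not_isSuccPrelimit_iff_mem_range_succ.1 hl
    have ht := (step_succ_iff hj.symm).1 h
    rw [ht.1]
    rw [← hj] at hs hκs hsc
    refine ⟨?_, succ_le_succ_iff.1 hs, ?_⟩
    · rcases hκs.eq_or_lt with h | h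
      · exact absurd h.symm ((isSuccPrelimit_ord hκ).succ_ne j)
      · exact lt_succ_iff.1 h
    · have := ht.2
      rw [hsc, mem_conn_succ_succ] at this
      obtain ⟨d, hd, hdt⟩ := this
      exact ⟨d, hd, hdt.symm⟩

theorem fewSuccessors_of_eq_conn {κ : Cardinal.{u}} (hκ : κ.IsRegular) {i : Ordinal.{u}}
    {c : ZFSet.{u}} (hc : c ∈ nu κ (succ i)) {s : State.{u}} (hκs : κ.ord ≤ s.1.1)
    (hs : s.1.1 ≤ succ i) (hsc : s.1.2 = conn s.1.1 (succ i) c) : FewSuccessors κ Step s := by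
  -- A first successor `t₀` serves only to name the level that all successors share.
  by_cases hne : ∃ t, Step s t
  · obtain ⟨t₀, ht₀⟩ := hne
    refine fewSuccessors_of_subset (conn t₀.1.1 i '' c)
      (Cardinal.mk_image_le.trans_lt (mk_coe_lt hc)) fun t ht => ?_
    obtain ⟨-, -, d, hd, h⟩ := ht.exists_eq_conn hκ hc hκs hs hsc
    exact ⟨d, hd, by rw [h, ht.level_eq ht₀]⟩
  · refine fewSuccessors_of_subset ∅ ?_ fun t ht => (hne ⟨t, ht⟩).elim
    simpa using hκ.pos

/-! ## Coalgebraic elements are branching -/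

/-- Being a projection of a coalgebra state at a level from `κ` on is preserved by transitions,
because each such projection comes from the next level. -/
theorem isBranching_of_eq_proj {κ : Cardinal.{u}} (hκ : κ.IsRegular) {X : Type u}
    (ζ : X → Set X) (hζ : ∀ x, Cardinal.mk (ζ x) < κ) {s : State.{u}} (hs : κ.ord ≤ s.1.1)
    {x : X} (hx : s.1.2 = proj ζ s.1.1 x) : IsBranching κ Step s := by
  intro t ht
  have key : κ.ord ≤ t.1.1 ∧ ∃ y, t.1.2 = proj ζ t.1.1 y := by
    induction ht with
    | refl => exact ⟨hs, x, hx⟩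
    | tail _ h ih =>
      obtain ⟨h1, y, hy⟩ := ih
      obtain ⟨h3, h4, d, hd, hdt⟩ := h.exists_eq_conn hκ (proj_mem_nu ζ hζ _ y) h1 (le_succ _)
        (by rw [conn_proj ζ (le_succ _), hy])
      obtain ⟨z, -, rfl⟩ := (mem_proj_succ ζ).1 hd
      exact ⟨h3, z, by rw [hdt, conn_proj ζ h4]⟩
  obtain ⟨h1, y, hy⟩ := key
  exact fewSuccessors_of_eq_conn hκ (proj_mem_nu ζ hζ _ y) h1 (le_succ _)
    (by rw [conn_proj ζ (le_succ _), hy])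

theorem IsCoalgebraic.isBranching {κ : Cardinal.{u}} (hκ : κ.IsRegular) {s : State.{u}}
    (hs : κ.ord ≤ s.1.1) (h : IsCoalgebraic κ s.1.1 s.1.2) : IsBranching κ Step s := by
  obtain ⟨X, ζ, x, hx⟩ := h
  exact isBranching_of_eq_proj hκ _ (fun y => (ζ y).2) hs hx

/-! ## Extending to successors at limit levels -/

/-- A branch through the levels from `l` on yields a successor. -/
theorem exists_mem_limitSucc {κ : WithTop Cardinal.{u}} {i l : Ordinal.{u}} (hi : IsSuccPrelimit i)
    (hl : l < i) {a : ZFSet.{u}} (ha : a ∈ nu κ i) (c : Ordinal.{u} → ZFSet.{u})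
    (hc : ∀ j < i, l ≤ j → c j ∈ conn (succ j) i a)
    (hcc : ∀ j k, l ≤ k → k ≤ j → j < i → conn k j (c j) = c k) :
    ∃ b ∈ limitSucc i a, ∀ j < i, l ≤ j → conn j i b = c j := by
  have hmax {j} (hj : j < i) : max j l < i := max_lt hj hl
  have hcn (j) (hj : j < i) (hlj : l ≤ j) : c j ∈ nu κ j :=
    (mem_nu_succ.1 (conn_mem ha (hi.succ_lt hj).le)).1 _ (hc j hj hlj)
  -- From `l` on this is `c j`; below `l` it is the image of `c l`.
  let x : ∀ j, j < i → ZFSet.{u} := fun j _ => conn j (max j l) (c (max j l))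
  have hx : tuple i x ∈ nu κ i := by
    refine (mem_nu_limit hi).2 ⟨x, fun j hj => ?_, fun k j hkj hj => ?_, rfl⟩
    · exact conn_mem (hcn _ (hmax hj) (le_max_right _ _)) (le_max_left _ _)
    · have h := hcn _ (hmax hj) (le_max_right _ _)
      simp only [x]
      rw [conn_conn h (le_max_left _ _) hkj, ← hcc (max j l) (max k l) (le_max_right _ _)
        (max_le_max_right l hkj) (hmax hj), conn_conn h (max_le_max_right l hkj) (le_max_left _ _)]
  refine ⟨tuple i x, ⟨nu_subset_nu_top κ i hx, fun j hj => ?_⟩, fun j hj hlj => ?_⟩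
  · rw [conn_tuple hi x hj, mem_conn_of_conn ha (hi.succ_lt (hmax hj)).le (le_max_left j l)]
    exact ⟨_, hc _ (hmax hj) (le_max_right _ _), rfl⟩
  · rw [conn_tuple hi x hj]
    simp [x, hlj, conn_self]

/-- Once `c` is lifted to a level from `κ` on, further preimages can be chosen independently:
injectivity makes them compatible. -/
theorem exists_mem_limitSucc_of_lt {κ : Cardinal.{u}} (hκ : κ.IsRegular) {i : Ordinal.{u}}
    (hi : IsSuccPrelimit i) (hκi : κ.ord < i) {a : ZFSet.{u}} (ha : a ∈ nu κ i) {k : Ordinal.{u}}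
    (hk : k < i) {c : ZFSet.{u}} (hc : c ∈ conn (succ k) i a) :
    ∃ b ∈ limitSucc i a, conn k i b = c := by
  have hl : max k κ.ord < i := max_lt hk hκi
  obtain ⟨c', hc', rfl⟩ := (mem_conn_of_conn ha (hi.succ_lt hl).le (le_max_left _ _)).1 hc
  have key : ∀ j < i, max k κ.ord ≤ j → ∃ d ∈ conn (succ j) i a, conn (max k κ.ord) j d = c' :=
    fun j hj hlj => (mem_conn_of_conn ha (hi.succ_lt hj).le hlj).1 hc'
  choose! d hd hdc using key
  have hdn (j) (hj : j < i) (hlj : max k κ.ord ≤ j) : d j ∈ nu κ j :=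
    (mem_nu_succ.1 (conn_mem ha (hi.succ_lt hj).le)).1 _ (hd j hj hlj)
  obtain ⟨b, hb, hbd⟩ := exists_mem_limitSucc hi hl ha d hd fun j m hm hmj hj => by
    have hmi := hmj.trans_lt hj
    refine conn_injOn hκ (le_max_right _ _) hm (conn_mem (hdn j hj (hm.trans hmj)) hmj)
      (hdn m hmi hm) ?_
    rw [conn_conn (hdn j hj (hm.trans hmj)) hmj hm, hdc j hj (hm.trans hmj), hdc m hmi hm]
  refine ⟨b, hb, ?_⟩
  rw [← conn_conn hb.1 hl.le (le_max_left _ _), hbd _ hl le_rfl, ← hdc _ hl le_rfl, conn_self]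

/-- The whole level `κ + ω`, a limit strictly above `κ`, is a coalgebra under `limitSucc`;
injectivity transfers the result to level `κ + j`. -/
theorem isCoalgebraic_of_omega0_le {κ : Cardinal.{u}} (hκ : κ.IsRegular) {j : Ordinal.{u}}
    (hj : Ordinal.omega0 ≤ j) {a : ZFSet.{u}} (ha : a ∈ nu κ (κ.ord + j)) :
    IsCoalgebraic κ (κ.ord + j) a := by
  have hlim : IsSuccPrelimit (κ.ord + Ordinal.omega0) :=
    (Ordinal.isSuccLimit_add _ Ordinal.isSuccLimit_omega0).isSuccPrelimit
  have hlt : κ.ord < κ.ord + Ordinal.omega0 := by simp [Ordinal.omega0_pos]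
  have hle : κ.ord + Ordinal.omega0 ≤ κ.ord + j := by gcongr
  refine isCoalgebraic_of_conn hκ hlt.le hle ha ?_
  refine isCoalgebraic_of_subcoalgebra (nu κ _) subset_rfl (limitSucc _)
    (fun b hb => limitSucc_subset hlim hb) (fun b hb => mk_limitSucc_lt_of_lt hκ hlim hlt hb)
    (fun b hb k hk c => ⟨fun hc => exists_mem_limitSucc_of_lt hκ hlim hlt hb hk hc, ?_⟩)
    (conn_mem ha hle)
  rintro ⟨d, hd, rfl⟩
  exact hd.2 k hk

/-! ## Consequences of the tree property -/

theorem exists_mem_limitSucc_of_treeProperty {κ : Cardinal.{u}} (hκ : κ.IsRegular)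
    (hT : TreeProperty κ) {a : ZFSet.{u}} (ha : a ∈ nu κ κ.ord) {k : Ordinal.{u}}
    (hk : k < κ.ord) {c : ZFSet.{u}} (hc : c ∈ conn (succ k) κ.ord a) :
    ∃ b ∈ limitSucc κ.ord a, conn k κ.ord b = c := by
  have hlim := isSuccPrelimit_ord hκ
  have hmax (m : Set.Iio κ.ord) : max m.1 k < κ.ord := max_lt m.2 hk
  have hsucc (m : Set.Iio κ.ord) : succ (max m.1 k) ≤ κ.ord := (hlim.succ_lt (hmax m)).le
  -- The tree of the extensions of `c` inside `a`. Through `max m k`, the levels `m ≤ k` are all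
  -- `{c}`, so that the tree is indexed by all of `κ`.
  let T : Set.Iio κ.ord → Set ZFSet.{u} := fun m =>
    {d | d ∈ conn (succ (max m.1 k)) κ.ord a ∧ conn k (max m.1 k) d = c}
  have hTn {m} {d} (hd : d ∈ T m) : d ∈ nu κ (max m.1 k) :=
    (mem_nu_succ.1 (conn_mem ha (hsucc m))).1 _ hd.1
  have hTs (m) : Small.{u} (T m) :=
    @small_subset _ _ _ (fun d hd => hd.1) (ZFSet.small_coe (conn (succ (max m.1 k)) κ.ord a))
  have hmono {m n : Set.Iio κ.ord} (h : m ≤ n) : max m.1 k ≤ max n.1 k := max_le_max_right k h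
  have hmap {m n} (h : m ≤ n) {d} (hd : d ∈ T n) : conn (max m.1 k) (max n.1 k) d ∈ T m := by
    refine ⟨(mem_conn_of_conn ha (hsucc n) (hmono h)).2 ⟨d, hd.1, rfl⟩, ?_⟩
    rw [conn_conn (hTn hd) (hmono h) (le_max_right _ _), hd.2]
  let D : InverseChain.{u + 1, u} (Set.Iio κ.ord) :=
    { obj := fun m => Shrink.{u} (T m)
      map := fun {m n} h x => equivShrink _ ⟨_, hmap h ((equivShrink (T n)).symm x).2⟩
      map_id := fun m x => by simp [conn_self]
      map_comp := fun {l m n} hlm hmn x => by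
        simp [conn_conn (hTn ((equivShrink (T n)).symm x).2) (hmono hmn) (hmono hlm)] }
  have hDmap {m n} (h : m ≤ n) (x : D.obj n) : ((equivShrink (T m)).symm (D.map h x)).1 =
      conn (max m.1 k) (max n.1 k) ((equivShrink (T n)).symm x).1 := by
    simp [D]
  have hDext {m} {x y : D.obj m}
      (h : ((equivShrink (T m)).symm x).1 = ((equivShrink (T m)).symm y).1) : x = y :=
    (equivShrink (T m)).symm.injective (Subtype.ext h)
  have htidy : D.IsTidyTree := by
    refine ⟨fun {m n} h x => ?_, fun m hm x y hxy => ?_, fun r _ => ?_⟩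
    · have hx := ((equivShrink (T m)).symm x).2
      obtain ⟨d, hd, hdx⟩ := (mem_conn_of_conn ha (hsucc n) (hmono h)).1 hx.1
      have hdn := (mem_nu_succ.1 (conn_mem ha (hsucc n))).1 _ hd
      refine ⟨equivShrink (T n) ⟨d, hd, ?_⟩, hDext ?_⟩
      · rw [← conn_conn hdn (hmono h) (le_max_right _ _), hdx, hx.2]
      · rw [hDmap]
        simpa using hdx
    · have hx := ((equivShrink (T m)).symm x).2
      have hy := ((equivShrink (T m)).symm y).2
      apply hDext
      rcases le_or_gt m.1 k with hmk | hmk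
      · have h1 := hx.2.trans hy.2.symm
        rw [max_eq_right hmk] at h1
        rwa [conn_self, conn_self] at h1
      · have hxn := hTn hx
        have hyn := hTn hy
        have hm' : IsSuccPrelimit m.1 := by
          intro j hj
          have hjm := hj.lt
          exact hm ⟨j, hjm.trans m.2⟩ ⟨hjm, fun z hz hz' => hj.2 (c := z.1) hz hz'⟩
        have hxy' (j) (hj : j < m.1) : conn (max j k) (max m.1 k) ((equivShrink (T m)).symm x).1 =
            conn (max j k) (max m.1 k) ((equivShrink (T m)).symm y).1 := by
          have h1 := hxy ⟨j, hj.trans m.2⟩ hj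
          rw [← hDmap (m := ⟨j, hj.trans m.2⟩) hj.le x, ← hDmap (m := ⟨j, hj.trans m.2⟩) hj.le y,
            h1]
        have hmm : max m.1 k = m.1 := max_eq_left hmk.le
        rw [hmm] at hxn hyn hxy'
        refine nu_limit_ext hm' hxn hyn fun j hj => ?_
        rw [← conn_conn hxn (max_lt hj hmk).le (le_max_left j k), hxy' j hj,
          conn_conn hyn (max_lt hj hmk).le (le_max_left j k)]
    · obtain ⟨d, hd, hdc⟩ := (mem_conn_of_conn ha (hsucc r) (le_max_right _ _)).1 hc
      exact ⟨equivShrink (T r) ⟨d, hd, hdc⟩⟩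
  have hcard (m) : Cardinal.mk (D.obj m) < κ := by
    rw [← Cardinal.lift_lt.{u, u + 1}]
    have : Cardinal.lift.{u + 1} (Cardinal.mk (Shrink.{u} (T m))) = Cardinal.mk (T m) :=
      Cardinal.lift_mk_shrink'' _
    rw [this]
    exact (Cardinal.mk_le_mk_of_subset fun d hd => hd.1).trans_lt (mk_coe_lt (conn_mem ha (hsucc m)))
  obtain ⟨x, hx⟩ := hT D htidy hcard
  let d : Ordinal.{u} → ZFSet.{u} := fun j =>
    if hj : j < κ.ord then ((equivShrink (T ⟨j, hj⟩)).symm (x ⟨j, hj⟩)).1 else ∅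
  have hd (j) (hj : j < κ.ord) : d j = ((equivShrink (T ⟨j, hj⟩)).symm (x ⟨j, hj⟩)).1 := dif_pos hj
  have hdT (j) (hj : j < κ.ord) : d j ∈ T ⟨j, hj⟩ := hd j hj ▸ Subtype.prop _
  obtain ⟨b, hb, hbd⟩ := exists_mem_limitSucc hlim hk ha d (fun j hj hkj => by
    have h1 := (hdT j hj).1
    rwa [show max j k = j from max_eq_left hkj] at h1) (fun j m hm hmj hj => by
    have hmκ := hmj.trans_lt hj
    have h1 := hDmap (m := ⟨m, hmκ⟩) (n := ⟨j, hj⟩) hmj (x ⟨j, hj⟩)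
    rw [hx, ← hd, ← hd, max_eq_left hm, max_eq_left (hm.trans hmj)] at h1
    exact h1.symm)
  refine ⟨b, hb, ?_⟩
  rw [hbd k hk le_rfl, ← (hdT k hk).2]
  simp [conn_self]

theorem ord_add_natCast_succ (κ : Cardinal.{u}) (n : ℕ) :
    κ.ord + ((n + 1 : ℕ) : Ordinal.{u}) = succ (κ.ord + n) := by
  rw [Nat.cast_add_one, ← add_assoc, succ_eq_add_one]

/-- The branching elements of level `κ` form a coalgebra under `limitSucc`: branching bounds the
successors, and the tree property makes them exhaust the components. -/
theorem isCoalgebraic_of_treeProperty {κ : Cardinal.{u}} (hκ : κ.IsRegular)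
    (hT : TreeProperty κ) (a : nu (κ : WithTop Cardinal.{u}) κ.ord)
    (h : IsBranching κ Step (toState a)) : IsCoalgebraic κ κ.ord a.1 := by
  have hlim := isSuccPrelimit_ord hκ
  have hstep (a b : nu (κ : WithTop Cardinal.{u}) κ.ord) (hb : b.1 ∈ limitSucc κ.ord a.1) :
      Step (toState a) (toState b) := (step_limit_iff hlim rfl).2 ⟨rfl, hb⟩
  refine isCoalgebraic_of_subcoalgebra
    {a | ∃ h : a ∈ nu κ κ.ord, IsBranching κ Step (toState ⟨a, h⟩)} (fun a ha => ha.1)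
    (limitSucc κ.ord) (fun a ha b hb => ?_) (fun a ha => ?_) (fun a ha k hk c => ?_) ⟨a.2, h⟩
  · have hb' := limitSucc_subset hlim ha.1 hb
    exact ⟨hb', (isBranching_iff.1 ha.2).2 _ (hstep ⟨a, ha.1⟩ ⟨b, hb'⟩ hb)⟩
  · exact mk_limitSucc_lt (s := toState ⟨a, ha.1⟩) hlim (isBranching_iff.1 ha.2).1
  · refine ⟨exists_mem_limitSucc_of_treeProperty hκ hT ha.1 hk, ?_⟩
    rintro ⟨b, hb, rfl⟩
    exact hb.2 k hk

/-- The successors of the image are images of members of `a`, which are branching and lie one level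
lower. -/
theorem isBranching_conn_ord {κ : Cardinal.{u}} (hκ : κ.IsRegular) (n : ℕ) {i : Ordinal.{u}}
    (hi : i = κ.ord + n) (hκi : κ.ord ≤ i) (a : nu (κ : WithTop Cardinal.{u}) i)
    (h : IsBranching κ Step (toState a)) :
    IsBranching κ Step (toState ⟨conn κ.ord i a.1, conn_mem a.2 hκi⟩) := by
  induction n generalizing i with
  | zero =>
    obtain rfl : i = κ.ord := by simpa using hi
    simpa [conn_self] using h
  | succ n ih =>
    rw [ord_add_natCast_succ] at hi
    subst hi
    rw [isBranching_iff]
    refine ⟨fewSuccessors_of_eq_conn hκ a.2 le_rfl hκi rfl, fun t ht => ?_⟩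
    obtain ⟨-, -, d, hd, hdt⟩ := ht.exists_eq_conn hκ a.2 le_rfl hκi rfl
    have htκ : t.1.1 = κ.ord := ((step_limit_iff (isSuccPrelimit_ord hκ) rfl).1 ht).1
    have hd' := (mem_nu_succ.1 a.2).1 d hd
    have hκn : κ.ord ≤ κ.ord + (n : Ordinal.{u}) := le_self_add
    have h1 := ih rfl hκn ⟨d, hd'⟩ ((isBranching_iff.1 h).2 _ ((step_succ_iff rfl).2 ⟨rfl, hd⟩))
    have : t = toState ⟨conn κ.ord _ d, conn_mem hd' hκn⟩ :=
      Subtype.ext (Prod.ext htκ (by rw [hdt, htκ]; rfl))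
    rwa [this]

theorem isCoalgebraic_of_isBranching {κ : Cardinal.{u}} (hκ : κ.IsRegular) {j : Ordinal.{u}}
    (hj : Ordinal.omega0 ≤ j ∨ TreeProperty κ) (a : nu (κ : WithTop Cardinal.{u}) (κ.ord + j))
    (h : IsBranching κ Step (toState a)) : IsCoalgebraic κ (κ.ord + j) a.1 := by
  rcases le_or_gt Ordinal.omega0 j with hωj | hωj
  · exact isCoalgebraic_of_omega0_le hκ hωj a.2
  · have hT := hj.resolve_left hωj.not_ge
    obtain ⟨n, rfl⟩ := Ordinal.lt_omega0.1 hωj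
    exact isCoalgebraic_of_conn hκ le_rfl le_self_add a.2
      (isCoalgebraic_of_treeProperty hκ hT _ (isBranching_conn_ord hκ n rfl le_self_add a h))

/-! ## The range of the connecting maps -/

/-- Each transition replaces `c` by one of its members, using up one of the `n` levels above `κ`. -/
theorem isBranchingAtDepth_of_eq_conn {κ : Cardinal.{u}} (hκ : κ.IsRegular) (n : ℕ)
    {i : Ordinal.{u}} (hi : i = κ.ord + n) {c : ZFSet.{u}} (hc : c ∈ nu κ i) {s : State.{u}}
    (hκs : κ.ord ≤ s.1.1) (hs : s.1.1 ≤ i) (hsc : s.1.2 = conn s.1.1 i c) :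
    IsBranchingAtDepth κ n Step s := by
  induction n generalizing i c s with
  | zero =>
    intro m hm
    simp at hm
  | succ n ih =>
    rw [ord_add_natCast_succ] at hi
    subst hi
    rw [isBranchingAtDepth_succ_iff]
    refine ⟨fewSuccessors_of_eq_conn hκ hc hκs hs hsc, fun t ht => ?_⟩
    obtain ⟨h1, h2, d, hd, hdt⟩ := ht.exists_eq_conn hκ hc hκs hs hsc
    exact ih rfl ((mem_nu_succ.1 hc).1 d hd) h1 h2 hdt

theorem isBranchingAtDepth_of_mem_range {κ : Cardinal.{u}} (hκ : κ.IsRegular) {j i : Ordinal.{u}}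
    (hji : j ≤ i) (a : nu (κ : WithTop Cardinal.{u}) (κ.ord + j))
    (h : a.1 ∈ conn (κ.ord + j) (κ.ord + i) '' nu κ (κ.ord + i)) :
    IsBranchingAtDepth κ i Step (toState a) := by
  obtain ⟨c, hc, hca⟩ := h
  have hle : κ.ord + j ≤ κ.ord + i := by gcongr
  rcases le_or_gt Ordinal.omega0 i with hωi | hωi
  · refine IsBranching.isBranchingAtDepth (IsCoalgebraic.isBranching hκ (le_self_add (b := j)) ?_) i
    have := (isCoalgebraic_of_omega0_le hκ hωi hc).conn hle
    rwa [hca] at this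
  · obtain ⟨n, rfl⟩ := Ordinal.lt_omega0.1 hωi
    exact isBranchingAtDepth_of_eq_conn hκ n rfl hc (le_self_add (b := j)) hle hca.symm

theorem exists_mem_nu_succ {κ : Cardinal.{u}} {j i : Ordinal.{u}} {E : Set ZFSet.{u}}
    (hE : Cardinal.mk E < Cardinal.lift.{u + 1} κ) (h : ∀ b ∈ E, b ∈ conn j i '' nu κ i) :
    ∃ c ∈ nu κ (succ i), ∀ x, (∃ d ∈ c, conn j i d = x) ↔ x ∈ E := by
  have _ := small_nu κ i
  have _ : Small.{u} E := small_subset h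
  choose! f hf hfE using h
  refine ⟨ZFSet.range fun b : E => f b, mem_nu_succ.2 ⟨fun c hc => ?_, ?_⟩, fun x => ?_⟩
  · obtain ⟨b, rfl⟩ := ZFSet.mem_range.1 hc
    exact hf _ b.2
  · have h1 := ZFSet.lift_card_range_le (f := fun b : E => f b)
    rw [Cardinal.lift_id'.{u, u + 1}] at h1
    exact WithTop.coe_lt_coe.2 (Cardinal.lift_lt.1 (h1.trans_lt hE))
  · constructor
    · rintro ⟨d, hd, rfl⟩
      obtain ⟨b, rfl⟩ := ZFSet.mem_range.1 hd
      rw [hfE _ b.2]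
      exact b.2
    · exact fun hx => ⟨f x, ZFSet.mem_range.2 ⟨⟨x, hx⟩, rfl⟩, hfE x hx⟩

/-- By induction every successor of `a` lifts to level `κ + n`; one lift for each gives the
preimage. At level `κ` itself, the tree property is needed to recover `a` from its successors. -/
theorem mem_range_of_treeProperty {κ : Cardinal.{u}} (hκ : κ.IsRegular) (hT : TreeProperty κ)
    {n m : ℕ} (hmn : m ≤ n) {i j : Ordinal.{u}} (hi : i = κ.ord + n) (hj : j = κ.ord + m)
    (a : nu (κ : WithTop Cardinal.{u}) j) (h : IsBranchingAtDepth κ n Step (toState a)) :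
    a.1 ∈ conn j i '' nu κ i := by
  induction n generalizing m i j with
  | zero =>
    obtain rfl := Nat.le_zero.1 hmn
    obtain rfl := hi.trans hj.symm
    exact ⟨a.1, a.2, conn_self _ _⟩
  | succ n ih =>
    rw [ord_add_natCast_succ] at hi
    subst hi
    rw [isBranchingAtDepth_succ_iff] at h
    cases m with
    | zero =>
      obtain rfl : j = κ.ord := by simpa using hj
      have hlim := isSuccPrelimit_ord hκ
      have hκn : κ.ord ≤ succ (κ.ord + (n : Ordinal.{u})) := le_self_add.trans (le_succ _)
      obtain ⟨c, hc, hcE⟩ := exists_mem_nu_succ (j := κ.ord) (i := κ.ord + n)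
        (mk_limitSucc_lt (s := toState a) hlim h.1) fun b hb => by
          have hb' := limitSucc_subset hlim a.2 hb
          exact ih (Nat.zero_le n) rfl (by simp) ⟨b, hb'⟩
            (h.2 (toState ⟨b, hb'⟩) ((step_limit_iff hlim rfl).2 ⟨rfl, hb⟩))
      refine ⟨c, hc, nu_limit_ext hlim (conn_mem hc hκn) a.2 fun k hk => ?_⟩
      have hsk := (hlim.succ_lt hk).le
      have : conn (succ k) κ.ord (conn κ.ord (succ (κ.ord + n)) c) = conn (succ k) κ.ord a.1 := by
        rw [conn_conn hc hκn hsk]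
        ext x
        rw [mem_conn_succ_succ]
        constructor
        · rintro ⟨d, hd, rfl⟩
          have h1 := (hcE _).1 ⟨d, hd, rfl⟩
          have h2 : conn k κ.ord _ ∈ conn (succ k) κ.ord a.1 := h1.2 k hk
          rwa [conn_conn ((mem_nu_succ.1 hc).1 d hd) le_self_add hk.le] at h2
        · intro hx
          obtain ⟨b, hb, rfl⟩ := exists_mem_limitSucc_of_treeProperty hκ hT a.2 hk hx
          obtain ⟨d, hd, rfl⟩ := (hcE b).2 hb
          exact ⟨d, hd, (conn_conn ((mem_nu_succ.1 hc).1 d hd) le_self_add hk.le).symm⟩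
      rw [← conn_conn (conn_mem hc hκn) hsk (le_succ k), this, conn_conn a.2 hsk (le_succ k)]
    | succ m =>
      rw [ord_add_natCast_succ] at hj
      subst hj
      obtain ⟨c, hc, hcE⟩ := exists_mem_nu_succ (j := κ.ord + m) (i := κ.ord + n)
        (mk_coe_lt a.2) fun b hb => by
          have hb' := (mem_nu_succ.1 a.2).1 b hb
          exact ih (Nat.le_of_succ_le_succ hmn) rfl rfl ⟨b, hb'⟩
            (h.2 (toState ⟨b, hb'⟩) ((step_succ_iff rfl).2 ⟨rfl, hb⟩))
      refine ⟨c, hc, ?_⟩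
      ext x
      rw [mem_conn_succ_succ]
      exact hcE x

/-! ## Failure of the tree property -/

/-- An element of level `κ` that is a nonempty tree without branches is branching, and so are its
iterated singletons, but it does not come from the next level. -/
theorem exists_isBranching_not_mem_range {κ : Cardinal.{u}} (hκ : κ.IsRegular) {a : ZFSet.{u}}
    (ha : a ∈ nu κ κ.ord) (hne : ∃ b, b ∈ conn (succ 0) κ.ord a) (hbr : limitSucc κ.ord a = ∅)
    (n : ℕ) {i : Ordinal.{u}} (hi : i = κ.ord + n) :
    ∃ b : nu (κ : WithTop Cardinal.{u}) i, IsBranching κ Step (toState b) ∧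
      b.1 ∉ conn i (succ i) '' nu κ (succ i) := by
  have hlim := isSuccPrelimit_ord hκ
  induction n generalizing i with
  | zero =>
    obtain rfl : i = κ.ord := by simpa using hi
    have hstep (t) (ht : Step (toState ⟨a, ha⟩) t) : t.1.2 ∈ (∅ : Set ZFSet.{u}) := by
      have := ((step_limit_iff hlim rfl).1 ht).2
      rwa [← hbr]
    refine ⟨⟨a, ha⟩, isBranching_iff.2 ⟨?_, fun t ht => (hstep t ht).elim⟩, ?_⟩
    · exact fewSuccessors_of_subset ∅ (by simpa using hκ.pos) hstep
    · rintro ⟨c, hc, rfl⟩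
      obtain ⟨b, hb⟩ := hne
      rw [conn_conn hc (le_succ _) (hlim.succ_lt hκ.ord_pos).le, mem_conn_succ_succ] at hb
      obtain ⟨d, hd, rfl⟩ := hb
      have hd' := (mem_nu_succ.1 hc).1 d hd
      -- A member of a lift of `a` would be a successor of `a`.
      have : d ∈ limitSucc κ.ord (conn κ.ord (succ κ.ord) c) := by
        refine ⟨nu_subset_nu_top _ _ hd', fun j hj => ?_⟩
        rw [conn_conn hc (le_succ _) (hlim.succ_lt hj).le, mem_conn_succ_succ]
        exact ⟨d, hd, rfl⟩
      rw [hbr] at this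
      exact this
  | succ n ih =>
    rw [ord_add_natCast_succ] at hi
    subst hi
    obtain ⟨b, hb, hb'⟩ := ih rfl
    have hs : ({b.1} : ZFSet.{u}) ∈ nu κ (succ (κ.ord + n)) := by
      refine mem_nu_succ.2 ⟨fun c hc => ?_, ?_⟩
      · rw [ZFSet.mem_singleton.1 hc]
        exact b.2
      · rw [ZFSet.card_singleton]
        exact WithTop.coe_lt_coe.2 (by exact_mod_cast hκ.nat_lt 1)
    refine ⟨⟨_, hs⟩, isBranching_iff.2 ⟨fewSuccessors_of_succ rfl hs, fun t ht => ?_⟩, ?_⟩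
    · have h1 := (step_succ_iff rfl).1 ht
      have : t = toState b := Subtype.ext (Prod.ext h1.1 (ZFSet.mem_singleton.1 h1.2))
      rwa [this]
    · rintro ⟨c, hc, hcb⟩
      have h1 : b.1 ∈ conn (succ (κ.ord + (n : Ordinal.{u}))) (succ (succ (κ.ord + n))) c := by
        rw [hcb]
        exact ZFSet.mem_singleton.2 rfl
      rw [mem_conn_succ_succ] at h1
      obtain ⟨d, hd, hdb⟩ := h1
      exact hb' ⟨d, (mem_nu_succ.1 hc).1 d hd, hdb⟩

/-! ## Sets of ordinals as coalgebra states -/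

/-- The position of an element of the well-order `κ`. -/
noncomputable def position {κ : Cardinal.{u}} (α : κ.ord.ToType) : Ordinal.{u} :=
  (Ordinal.ToType.mk.symm α).1

theorem position_lt {κ : Cardinal.{u}} (α : κ.ord.ToType) : position α < κ.ord :=
  (Ordinal.ToType.mk.symm α).2

theorem position_lt_position {κ : Cardinal.{u}} {α β : κ.ord.ToType} :
    position α < position β ↔ α < β :=
  Ordinal.ToType.mk.symm.lt_iff_lt

theorem position_injective {κ : Cardinal.{u}} :
    Function.Injective (position : κ.ord.ToType → Ordinal.{u}) :=
  Subtype.val_injective.comp Ordinal.ToType.mk.symm.injective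

theorem exists_position_eq {κ : Cardinal.{u}} {δ : Ordinal.{u}} (hδ : δ < κ.ord) :
    ∃ α : κ.ord.ToType, position α = δ :=
  ⟨Ordinal.ToType.mk ⟨δ, hδ⟩, by simp [position]⟩

theorem mk_Iio_lt_of_ord {κ : Cardinal.{u}} (α : κ.ord.ToType) : Cardinal.mk (Set.Iio α) < κ :=
  (Cardinal.mk_Iio_lt α (by simp)).trans_eq (Cardinal.mk_ord_toType κ)

/-- The coalgebra of subsets of `κ` of size `<κ`: a set has as successors its elements, regarded as
initial segments. -/
def BoundedSet (κ : Cardinal.{u}) : Type u := {S : Set κ.ord.ToType // Cardinal.mk S < κ}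

/-- An element of `κ`, regarded as an initial segment. -/
def initialSegment {κ : Cardinal.{u}} (α : κ.ord.ToType) : BoundedSet κ :=
  ⟨Set.Iio α, mk_Iio_lt_of_ord α⟩

/-- The coalgebra structure of `BoundedSet κ`. -/
def BoundedSet.succs {κ : Cardinal.{u}} (S : BoundedSet κ) : Set (BoundedSet κ) :=
  initialSegment '' S.1

theorem mk_succs_lt {κ : Cardinal.{u}} (S : BoundedSet κ) : Cardinal.mk S.succs < κ :=
  Cardinal.mk_image_le.trans_lt S.2

variable {κ : Cardinal.{u}}

theorem mem_proj_boundedSet {δ : Ordinal.{u}} {S : BoundedSet κ} {c : ZFSet.{u}} :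
    c ∈ proj BoundedSet.succs (succ δ) S ↔
      ∃ α ∈ S.1, proj BoundedSet.succs δ (initialSegment α) = c := by
  rw [mem_proj_succ]
  simp [BoundedSet.succs]

/-- The `δ`-th projection cannot tell apart ordinals from `δ` on: at `δ + 1`, a member of `α`
outside `β` is replaced by the ordinal `δ`. -/
theorem proj_initialSegment_eq {δ : Ordinal.{u}} {α β : κ.ord.ToType} (hα : δ ≤ position α)
    (hβ : δ ≤ position β) : proj BoundedSet.succs δ (initialSegment α) =
      proj BoundedSet.succs δ (initialSegment β) := by
  induction δ using SuccOrder.prelimitRecOn generalizing α β with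
  | isSuccPrelimit δ hδ ih =>
    rw [proj_limit _ hδ, proj_limit _ hδ]
    exact tuple_congr fun j hj => ih j hj (hj.le.trans hα) (hj.le.trans hβ)
  | succ δ _ ih =>
    have key {α β : κ.ord.ToType} (hβ : succ δ ≤ position β) (c)
        (hc : c ∈ proj BoundedSet.succs (succ δ) (initialSegment α)) :
        c ∈ proj BoundedSet.succs (succ δ) (initialSegment β) := by
      rw [mem_proj_boundedSet] at hc ⊢
      obtain ⟨ξ, hξ, rfl⟩ := hc
      by_cases h : ξ < β
      · exact ⟨ξ, h, rfl⟩
      · have hδ := succ_le_iff.1 hβ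
        obtain ⟨ξ', rfl⟩ := exists_position_eq (hδ.trans (position_lt β))
        refine ⟨ξ', position_lt_position.1 hδ, ih le_rfl (hδ.le.trans ?_)⟩
        exact le_of_not_gt fun h' => h (position_lt_position.1 h')
    ext c
    exact ⟨key hβ c, key hα c⟩

/-- Level `α + 1` suffices: as `α ∈ β`, some `ξ < α` would have the same projection at level `α` as
`α`, contrary to the induction hypothesis. -/
theorem proj_initialSegment_ne {δ : Ordinal.{u}} {α β : κ.ord.ToType} (hα : position α < δ)
    (hαβ : α < β) : proj BoundedSet.succs δ (initialSegment α) ≠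
      proj BoundedSet.succs δ (initialSegment β) := by
  induction α using WellFoundedLT.induction generalizing β δ with
  | ind α ih =>
    intro h
    have h1 := congrArg (conn (succ (position α)) δ) h
    rw [conn_proj _ (succ_le_iff.2 hα), conn_proj _ (succ_le_iff.2 hα), ZFSet.ext_iff] at h1
    obtain ⟨ξ, hξ, h2⟩ := mem_proj_boundedSet.1 ((h1 _).2 (mem_proj_boundedSet.2 ⟨α, hαβ, rfl⟩))
    exact ih ξ hξ (position_lt_position.2 hξ) hξ h2

theorem eq_of_proj_initialSegment_eq {δ : Ordinal.{u}} {α β : κ.ord.ToType} (hα : position α < δ)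
    (h : proj BoundedSet.succs δ (initialSegment β) =
      proj BoundedSet.succs δ (initialSegment α)) : β = α := by
  rcases lt_trichotomy α β with h' | h' | h'
  · exact (proj_initialSegment_ne hα h' h.symm).elim
  · exact h'.symm
  · exact (proj_initialSegment_ne ((position_lt_position.2 h').trans hα) h' h).elim

theorem proj_boundedSet_eq {δ : Ordinal.{u}} {S T : BoundedSet κ}
    (hS : ∃ α ∈ S.1, δ ≤ position α) (hT : ∃ α ∈ T.1, δ ≤ position α)
    (h : ∀ α, position α < δ → (α ∈ S.1 ↔ α ∈ T.1)) :
    proj BoundedSet.succs δ S = proj BoundedSet.succs δ T := by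
  induction δ using SuccOrder.prelimitRecOn with
  | isSuccPrelimit δ hδ ih =>
    rw [proj_limit _ hδ, proj_limit _ hδ]
    refine tuple_congr fun j hj => ih j hj ?_ ?_ fun α hα => h α (hα.trans hj)
    · exact hS.imp fun α hα => ⟨hα.1, hj.le.trans hα.2⟩
    · exact hT.imp fun α hα => ⟨hα.1, hj.le.trans hα.2⟩
  | succ δ _ _ =>
    have key {S T : BoundedSet κ} (hT : ∃ α ∈ T.1, succ δ ≤ position α)
        (h : ∀ α, position α < succ δ → α ∈ S.1 → α ∈ T.1) (c)
        (hc : c ∈ proj BoundedSet.succs (succ δ) S) : c ∈ proj BoundedSet.succs (succ δ) T := by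
      rw [mem_proj_boundedSet] at hc ⊢
      obtain ⟨α, hα, rfl⟩ := hc
      rcases lt_or_ge (position α) (succ δ) with h' | h'
      · exact ⟨α, h α h' hα, rfl⟩
      · obtain ⟨β, hβ, hβδ⟩ := hT
        exact ⟨β, hβ, proj_initialSegment_eq ((le_succ δ).trans hβδ) ((le_succ δ).trans h')⟩
    ext c
    exact ⟨key hT (fun α h' => (h α h').1) c, key hS (fun α h' => (h α h').2) c⟩

/-- The set that agrees with `A` below `γ` and has `γ` as its last element. -/
noncomputable def truncate (hκ : κ.IsRegular) (γ : κ.ord.ToType) (A : Set κ.ord.ToType) :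
    BoundedSet κ :=
  ⟨insert γ (A ∩ Set.Iio γ), by
    refine Cardinal.mk_insert_le.trans_lt (Cardinal.add_lt_of_lt hκ.aleph0_le ?_ ?_)
    · exact (Cardinal.mk_le_mk_of_subset Set.inter_subset_right).trans_lt
        (mk_Iio_lt_of_ord γ)
    · exact_mod_cast hκ.nat_lt 1⟩

theorem mem_truncate {hκ : κ.IsRegular} {γ : κ.ord.ToType} {A : Set κ.ord.ToType}
    {α : κ.ord.ToType} (hα : α < γ) : α ∈ (truncate hκ γ A).1 ↔ α ∈ A := by
  simp [truncate, hα, hα.ne]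

theorem truncate_congr {hκ : κ.IsRegular} {γ : κ.ord.ToType} {A B : Set κ.ord.ToType}
    (h : ∀ α < γ, α ∈ A ↔ α ∈ B) : truncate hκ γ A = truncate hκ γ B := by
  refine Subtype.ext (congrArg (insert γ) (Set.ext fun α => ?_))
  exact and_congr_left fun hα => h α hα

/-- The reason for adding the end point: both sets contain an element from `δ` on, and all such
elements look alike at `δ`, so only the part of `A` below `δ` counts. -/
theorem proj_truncate {hκ : κ.IsRegular} {γ δ : κ.ord.ToType} (hδγ : δ ≤ γ)
    (A : Set κ.ord.ToType) : proj BoundedSet.succs (position δ) (truncate hκ γ A) =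
      proj BoundedSet.succs (position δ) (truncate hκ δ A) := by
  have hle : position δ ≤ position γ := le_of_not_gt fun h => hδγ.not_gt (position_lt_position.1 h)
  refine proj_boundedSet_eq ⟨γ, .inl rfl, hle⟩ ⟨δ, .inl rfl, le_rfl⟩ fun α hα => ?_
  have hα' := position_lt_position.1 hα
  rw [mem_truncate hα', mem_truncate (hα'.trans_le hδγ)]

/-! ## Aronszajn trees in the final chain -/

theorem exists_nu_limit {κ : WithTop Cardinal.{u}} {i : Ordinal.{u}} (hi : IsSuccPrelimit i)
    (T : Ordinal.{u} → ZFSet.{u}) (hT : ∀ k < i, T k ∈ nu κ (succ k))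
    (hTT : ∀ k j, k ≤ j → j < i → conn (succ k) (succ j) (T j) = T k) :
    ∃ a ∈ nu κ i, ∀ k < i, conn (succ k) i a = T k := by
  refine ⟨tuple i fun j _ => conn j (succ j) (T j), (mem_nu_limit hi).2
    ⟨_, fun j hj => conn_mem (hT j hj) (le_succ j), fun k j hkj hj => ?_, rfl⟩, fun k hk => ?_⟩
  · rw [conn_conn (hT j hj) (le_succ j) hkj, ← hTT k j hkj hj,
      conn_conn (hT j hj) (succ_le_succ hkj) (le_succ k)]
  · rw [conn_tuple hi _ (hi.succ_lt hk), hTT k (succ k) (le_succ k) (hi.succ_lt hk)]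

theorem exists_bound (hκ : κ.IsRegular) {ι : Type (u + 1)}
    (hι : Cardinal.mk ι < Cardinal.lift.{u + 1} κ) (f : ι → Ordinal.{u}) (hf : ∀ x, f x < κ.ord) :
    ∃ m < κ.ord, ∀ x, f x ≤ m := by
  refine ⟨⨆ x, f x, ?_, fun x => le_ciSup ⟨κ.ord, ?_⟩ x⟩
  · apply Ordinal.lift_iSup_lt_of_lt_cof _ hf
    rwa [← Ordinal.lift_cof, hκ.cof_ord, Cardinal.lift_id'.{u, u + 1}]
  · rintro _ ⟨x, rfl⟩
    exact (hf x).le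

theorem exists_injective_nodes (hκ : κ.IsRegular) (D : Set.Iio κ.ord → Type u)
    (hD : ∀ m, Cardinal.mk (D m) < κ) :
    ∃ e : (Σ m, D m) → κ.ord.ToType, Function.Injective e := by
  have h (m) : Nonempty (D m ↪ κ.ord.ToType) := by
    have := (hD m).le
    rw [← Cardinal.mk_ord_toType κ] at this
    exact this
  have h2 : Nonempty (κ.ord.ToType × κ.ord.ToType ↪ κ.ord.ToType) := by
    rw [← Cardinal.le_def, Cardinal.mk_prod]
    simp [Cardinal.mul_eq_self hκ.aleph0_le]
  obtain ⟨g⟩ := h2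
  refine ⟨fun x => g (Ordinal.ToType.mk x.1, (h x.1).some x.2), ?_⟩
  rintro ⟨m, x⟩ ⟨n, y⟩ hxy
  have h3 := Prod.ext_iff.1 (g.injective hxy)
  obtain rfl := Ordinal.ToType.mk.injective h3.1
  exact congrArg (Sigma.mk m) ((h m).some.injective h3.2)

/-- The nodes of a tree without full branch are numbered by ordinals below `κ`, and a node is coded
by the set of numbers of the nodes below it, itself included. Component `γ + 1` of `a` consists of
the codes truncated at `γ`. A successor of `a` would code a set of numbers that is a full branch. -/
theorem exists_limitSucc_eq_empty (hκ : κ.IsRegular) (hT : ¬ TreeProperty κ) :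
    ∃ a ∈ nu κ κ.ord, (∃ b, b ∈ conn (succ 0) κ.ord a) ∧ limitSucc κ.ord a = ∅ := by
  have hlim := isSuccPrelimit_ord hκ
  simp only [TreeProperty, not_forall] at hT
  obtain ⟨D, hD, hcard, hno⟩ := hT
  obtain ⟨e, he⟩ := exists_injective_nodes hκ D.obj hcard
  have hne (m) : Nonempty (D.obj m) := by
    have hbot : IsBot (⟨0, hκ.ord_pos⟩ : Set.Iio κ.ord) := fun m => zero_le (a := m.1)
    obtain ⟨r⟩ := hD.root _ hbot
    obtain ⟨x, -⟩ := hD.surjective (hbot m) r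
    exact ⟨x⟩
  -- Nothing is claimed from `κ` on, so that choice yields a total function; likewise for `K` and
  -- `x`.
  have hW (γ : Ordinal.{u}) : ∃ α : κ.ord.ToType, γ < κ.ord → position α = γ := by
    by_cases h : γ < κ.ord
    · exact (exists_position_eq h).imp fun _ h' _ => h'
    · exact (exists_position_eq hκ.ord_pos).imp fun _ _ h' => (h h').elim
  choose pt hpt using hW
  have hptle {γ δ : Ordinal.{u}} (hδγ : δ ≤ γ) (hγ : γ < κ.ord) : pt δ ≤ pt γ := by
    refine le_of_not_gt fun h => ?_
    rw [← position_lt_position, hpt γ hγ, hpt δ (hδγ.trans_lt hγ)] at h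
    exact h.not_ge hδγ
  -- the set of nodes below a node
  let A : ∀ m, D.obj m → Set κ.ord.ToType :=
    fun m x => {α | ∃ (l : _) (hl : l ≤ m), e ⟨l, D.map hl x⟩ = α}
  -- the level `K γ` is above all the nodes that are numbered below `γ`
  have hK (γ : Ordinal.{u}) : ∃ m : Set.Iio κ.ord, γ < κ.ord → ∀ z, position (e z) < γ →
      z.1 ≤ m := by
    by_cases hγ : γ < κ.ord
    · obtain ⟨m, hm, h⟩ := exists_bound hκ (ι := {z // position (e z) < γ}) (by
        have : Function.Injective (fun z : {z // position (e z) < γ} =>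
            (⟨position (e z.1), z.2⟩ : Set.Iio γ)) := fun z z' h =>
          Subtype.ext (he (position_injective (congrArg (fun ξ : Set.Iio γ => ξ.1) h)))
        refine (Cardinal.mk_le_of_injective this).trans_lt ?_
        rw [Cardinal.mk_Iio_ordinal, Cardinal.lift_lt]
        exact Cardinal.lt_ord.1 hγ) (fun z => z.1.1.1) (fun z => z.1.1.2)
      exact ⟨⟨m, hm⟩, fun _ z hz => h ⟨z, hz⟩⟩
    · exact ⟨⟨0, hκ.ord_pos⟩, fun h => (hγ h).elim⟩
  choose K hK using hK
  -- Above all nodes numbered below `γ`, every level gives the same codes up to `γ`; surjectivity is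
  -- used to go up.
  have hA {γ : Ordinal.{u}} {m n} (hm : ∀ z, position (e z) < γ → z.1 ≤ m)
      (hn : ∀ z, position (e z) < γ → z.1 ≤ n) (x : D.obj m) :
      ∃ y : D.obj n, ∀ α, position α < γ → (α ∈ A m x ↔ α ∈ A n y) := by
    rcases le_total m n with hmn | hmn
    · obtain ⟨y, rfl⟩ := hD.surjective hmn x
      refine ⟨y, fun α hα => ⟨?_, ?_⟩⟩
      · rintro ⟨l, hl, rfl⟩
        exact ⟨l, hl.trans hmn, by rw [D.map_comp]⟩
      · rintro ⟨l, hl, rfl⟩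
        exact ⟨l, hm _ hα, by rw [D.map_comp]⟩
    · refine ⟨D.map hmn x, fun α hα => ⟨?_, ?_⟩⟩
      · rintro ⟨l, hl, rfl⟩
        exact ⟨l, hn _ hα, by rw [D.map_comp]⟩
      · rintro ⟨l, hl, rfl⟩
        exact ⟨l, hl.trans hmn, by rw [D.map_comp]⟩
  let F : ∀ γ m, D.obj m → ZFSet.{u} := fun γ m x =>
    proj BoundedSet.succs γ (truncate hκ (pt γ) (A m x))
  let T : Ordinal.{u} → ZFSet.{u} := fun γ => ZFSet.range (F γ (K γ))
  have hFconn {δ γ : Ordinal.{u}} (hδγ : δ ≤ γ) (hγ : γ < κ.ord) (m) (x : D.obj m) :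
      conn δ γ (F γ m x) = F δ m x := by
    have h1 := proj_truncate (hκ := hκ) (hptle hδγ hγ) (A m x)
    rw [hpt δ (hδγ.trans_lt hγ)] at h1
    exact (conn_proj _ hδγ _).trans h1
  have hFA {γ : Ordinal.{u}} (hγ : γ < κ.ord) {m n} {x : D.obj m} {y : D.obj n}
      (h : ∀ α, position α < γ → (α ∈ A m x ↔ α ∈ A n y)) : F γ m x = F γ n y := by
    refine congrArg (proj _ γ) (truncate_congr fun α hα => h α ?_)
    rwa [← hpt γ hγ, position_lt_position]
  obtain ⟨a, ha, haT⟩ := exists_nu_limit (κ := κ) hlim T (fun γ hγ => by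
    refine mem_nu_succ.2 ⟨fun b hb => ?_, ?_⟩
    · obtain ⟨x, rfl⟩ := ZFSet.mem_range.1 hb
      exact proj_mem_nu _ mk_succs_lt _ _
    · exact WithTop.coe_lt_coe.2 ((Cardinal.lift_le.1 ZFSet.lift_card_range_le).trans_lt
        (hcard (K γ)))) (fun δ γ hδγ hγ => by
    have hδ := hδγ.trans_lt hγ
    have hKδ : ∀ z, position (e z) < δ → z.1 ≤ K γ := fun z hz => hK γ hγ z (hz.trans_le hδγ)
    ext c
    rw [mem_conn_succ_succ, ZFSet.mem_range]
    constructor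
    · rintro ⟨_, hb, rfl⟩
      obtain ⟨x, rfl⟩ := ZFSet.mem_range.1 hb
      obtain ⟨y, hy⟩ := hA hKδ (hK δ hδ) x
      exact ⟨y, by rw [hFconn hδγ hγ, hFA hδ hy]⟩
    · rintro ⟨y, rfl⟩
      obtain ⟨x, hx⟩ := hA (hK δ hδ) hKδ y
      exact ⟨_, ZFSet.mem_range_self x, by rw [hFconn hδγ hγ, hFA hδ hx]⟩)
  refine ⟨a, ha, ?_, Set.eq_empty_of_forall_notMem fun b hb => hno ?_⟩
  · rw [haT 0 hκ.ord_pos]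
    exact ⟨_, ZFSet.mem_range_self (hne _).some⟩
  have hbT (γ : Ordinal.{u}) : ∃ x : D.obj (K γ), γ < κ.ord → conn γ κ.ord b = F γ (K γ) x := by
    by_cases hγ : γ < κ.ord
    · have := hb.2 γ hγ
      rw [haT γ hγ] at this
      obtain ⟨x, hx⟩ := ZFSet.mem_range.1 this
      exact ⟨x, fun _ => hx.symm⟩
    · exact ⟨(hne _).some, fun h => (hγ h).elim⟩
  choose x hx using hbT
  -- the set of numbers of nodes that is coded by `b`
  let Q : Set κ.ord.ToType := {α | proj BoundedSet.succs (succ (position α)) (initialSegment α) ∈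
    conn (succ (succ (position α))) κ.ord b}
  -- The projection at `α + 1` tells `α` from all other ordinals, so membership of `α` is visible
  -- from level `α + 2` on.
  have hQ (α : κ.ord.ToType) {γ : Ordinal.{u}} (hαγ : succ (position α) < γ) (hγ : γ < κ.ord) :
      α ∈ Q ↔ α ∈ A (K γ) (x γ) := by
    have hα : α < pt γ := by
      rw [← position_lt_position, hpt γ hγ]
      exact (lt_succ _).trans hαγ
    rw [← mem_truncate (hκ := hκ) (A := A (K γ) (x γ)) hα]
    have h1 : conn (succ (succ (position α))) κ.ord b =
        proj BoundedSet.succs (succ (succ (position α))) (truncate hκ (pt γ) (A (K γ) (x γ))) := by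
      rw [← conn_conn hb.1 hγ.le (succ_le_iff.2 hαγ), hx γ hγ]
      exact conn_proj _ (succ_le_iff.2 hαγ) _
    change _ ∈ conn _ _ _ ↔ _
    rw [h1, mem_proj_boundedSet]
    constructor
    · rintro ⟨β, hβ, h⟩
      rwa [← eq_of_proj_initialSegment_eq (lt_succ _) h]
    · exact fun h => ⟨α, h, rfl⟩
  -- all the nodes of level `m` are numbered below `G m`
  have hG (m) : ∃ γ < κ.ord, ∀ y : D.obj m, succ (position (e ⟨m, y⟩)) < γ := by
    obtain ⟨γ, hγ, h⟩ := exists_bound hκ (ι := ULift.{u + 1} (D.obj m))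
      (by simpa using hcard m) (fun y => succ (position (e ⟨m, y.down⟩)))
      (fun y => hlim.succ_lt (position_lt _))
    exact ⟨succ γ, hlim.succ_lt hγ, fun y => lt_succ_iff.2 (h ⟨y⟩)⟩
  choose G hGκ hG using hG
  have hGK {m} {γ : Ordinal.{u}} (hγ : γ < κ.ord) (hm : G m ≤ γ) : m ≤ K γ :=
    hK γ hγ ⟨m, (hne m).some⟩ ((lt_succ _).trans ((hG m _).trans_le hm))
  -- So `Q` contains the number of exactly one node of level `m`; these nodes form the branch, and
  -- two levels are compared through a common `γ`.
  have hGx {m} {γ : Ordinal.{u}} (hγ : γ < κ.ord) (hm : G m ≤ γ) (y : D.obj m) :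
      e ⟨m, y⟩ ∈ Q ↔ y = D.map (hGK hγ hm) (x γ) := by
    rw [hQ _ ((hG m y).trans_le hm) hγ]
    constructor
    · rintro ⟨l, hl, h⟩
      obtain ⟨rfl, h'⟩ := Sigma.mk.inj_iff.1 (he h)
      exact (eq_of_heq h').symm
    · rintro rfl
      exact ⟨m, hGK hγ hm, rfl⟩
  refine ⟨fun m => D.map (hGK (hGκ m) le_rfl) (x (G m)), fun m n hmn => ?_⟩
  have hmax := max_lt (hGκ m) (hGκ n)
  have hm := (hGx hmax (le_max_left _ _) _).1 ((hGx (hGκ m) le_rfl _).2 rfl)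
  have hn := (hGx hmax (le_max_right _ _) _).1 ((hGx (hGκ n) le_rfl _).2 rfl)
  exact ((congrArg (D.map hmn) hn).trans (D.map_comp _ _ _)).trans hm.symm

end FinalChain

/-! ### The counterexample at finite `j` and the two equivalences -/

open FinalChain in
theorem exists_not_mem_range_of_not_treeProperty {κ : Cardinal.{u}} (hκ : κ.IsRegular)
    (hT : ¬ TreeProperty κ) {j : Ordinal.{u}} (hj : j < Ordinal.omega0) :
    ∃ a : nu (κ : WithTop Cardinal.{u}) (κ.ord + j), IsBranching κ Step (toState a) ∧
      ∀ i, j < i → a.1 ∉ conn (κ.ord + j) (κ.ord + i) '' nu κ (κ.ord + i) := by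
  obtain ⟨n, rfl⟩ := Ordinal.lt_omega0.1 hj
  obtain ⟨a, ha, hne, hbr⟩ := exists_limitSucc_eq_empty hκ hT
  obtain ⟨b, hb, hb'⟩ := exists_isBranching_not_mem_range hκ ha hne hbr n rfl
  refine ⟨b, hb, fun i hi => ?_⟩
  rintro ⟨c, hc, hcb⟩
  -- A lift to any later level would yield one to the next level.
  have hle : succ (κ.ord + (n : Ordinal.{u})) ≤ κ.ord + i := by
    rw [succ_le_iff]
    gcongr
  exact hb' ⟨_, conn_mem hc hle, by rw [conn_conn hc hle (le_succ _), hcb]⟩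

theorem proposition7p16 (κ : Cardinal.{u}) (hκ : κ.IsRegular) :
    (∀ j : Ordinal.{u},
      (∀ a : FinalChain.nu (κ : WithTop Cardinal.{u}) (κ.ord + j),
        FinalChain.IsCoalgebraic κ (κ.ord + j) a.1 →
          IsBranching κ FinalChain.Step (FinalChain.toState a)) ∧
      ((∀ a : FinalChain.nu (κ : WithTop Cardinal.{u}) (κ.ord + j),
        IsBranching κ FinalChain.Step (FinalChain.toState a) →
          FinalChain.IsCoalgebraic κ (κ.ord + j) a.1) ↔
        (Ordinal.omega0 ≤ j ∨ TreeProperty κ))) ∧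
    (∀ j i : Ordinal.{u}, j ≤ i →
      (∀ a : FinalChain.nu (κ : WithTop Cardinal.{u}) (κ.ord + j),
        a.1 ∈ FinalChain.conn (κ.ord + j) (κ.ord + i) '' FinalChain.nu κ (κ.ord + i) →
          IsBranchingAtDepth κ i FinalChain.Step (FinalChain.toState a)) ∧
      ((∀ a : FinalChain.nu (κ : WithTop Cardinal.{u}) (κ.ord + j),
        IsBranchingAtDepth κ i FinalChain.Step (FinalChain.toState a) →
          a.1 ∈ FinalChain.conn (κ.ord + j) (κ.ord + i) '' FinalChain.nu κ (κ.ord + i)) ↔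
        (j = i ∨ Ordinal.omega0 ≤ j ∨ TreeProperty κ))) := by
  refine ⟨fun j => ⟨fun a ha => ?_, fun h => ?_, fun hj a ha => ?_⟩, fun j i hji =>
    ⟨FinalChain.isBranchingAtDepth_of_mem_range hκ hji, fun h => ?_, fun hj a ha => ?_⟩⟩
  · exact FinalChain.IsCoalgebraic.isBranching hκ (le_self_add (b := j)) ha
  · by_contra! hj
    obtain ⟨a, ha, ha'⟩ := exists_not_mem_range_of_not_treeProperty hκ hj.2 hj.1
    have hle : κ.ord + j ≤ κ.ord + succ j := by
      gcongr
      exact le_succ j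
    obtain ⟨c, hc, -, hca⟩ := (h a ha).exists_conn_eq hle
    exact ha' _ (lt_succ j) ⟨c, hc, hca⟩
  · exact FinalChain.isCoalgebraic_of_isBranching hκ hj a ha
  · by_contra! hj
    obtain ⟨a, ha, ha'⟩ := exists_not_mem_range_of_not_treeProperty hκ hj.2.2 hj.2.1
    exact ha' i (lt_of_le_of_ne hji hj.1) (h a (ha.isBranchingAtDepth i))
  · rcases hj with rfl | hj
    · exact ⟨a.1, a.2, FinalChain.conn_self _ _⟩
    have hle : κ.ord + j ≤ κ.ord + i := by gcongr
    have key (h : FinalChain.IsCoalgebraic κ (κ.ord + j) a.1) :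
        a.1 ∈ FinalChain.conn (κ.ord + j) (κ.ord + i) '' FinalChain.nu κ (κ.ord + i) := by
      obtain ⟨c, hc, -, hca⟩ := h.exists_conn_eq hle
      exact ⟨c, hc, hca⟩
    rcases le_or_gt Ordinal.omega0 j with hωj | hωj
    · exact key (FinalChain.isCoalgebraic_of_omega0_le hκ hωj a.2)
    · rcases le_or_gt Ordinal.omega0 i with hωi | hωi
      -- For infinite `i`, branching at depth `<i` is full branching, and coalgebraic elements lift
      -- to every level.
      · exact key (FinalChain.isCoalgebraic_of_isBranching hκ hj a (ha.isBranching hωi))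
      · obtain ⟨n, rfl⟩ := Ordinal.lt_omega0.1 hωi
        obtain ⟨m, rfl⟩ := Ordinal.lt_omega0.1 hωj
        exact FinalChain.mem_range_of_treeProperty hκ (hj.resolve_left hωj.not_ge)
          (Nat.cast_le.1 hji) rfl rfl a ha
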